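/- **Setting.** Let $\Bbbk$ be a field and let $H$ be a finite-dimensional Hopf algebra over $\Bbbk$ with comultiplication $\Delta(h)=h_{(1)}\otimes h_{(2)}$, counit $\varepsilon$ and (automatically bijective) antipode $S$. Let $\hat H=H^*$ be the dual Hopf algebra: $(\omega\theta)(h)=\omega(h_{(1)})\theta(h_{(2)})$ and $\omega_{(1)}(g)\,\omega_{(2)}(h)=\omega(gh)$. Let $U=\sum_i h_i\otimes h^i\in H\otimes\hat H$ be the canonical element (for dual bases $(h_i)$, $(h^i)$) and ${}^{\circ}U=\sum_i h_i^{\mathrm{op}}\otimes h^i\in H^{\mathrm{op}}\otimes\hat H$; both are invertible. Here $H^{\mathrm{op}}$ is the Hopf algebra with opposite multiplication and the same comultiplication. Put $\mathrm{Ad}(u)(x)=uxu^{-1}$, and let $\Sigma$ denote flips of tensor factors. *Codouble and double.* The Drinfeld codouble $\mathcal T(H)$ is the Hopf algebra with underlying algebra $H^{\mathrm{op}}\otimes\hat H$ and comultiplication $\Delta_{\mathcal T(H)}=(\mathrm{id}\otimes\Sigma\,\mathrm{Ad}({}^{\circ}U)\otimes\mathrm{id})(\Delta_{H^{\mathrm{op}}}\otimes\Delta_{\hat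 H})$. The Drinfeld double $\mathcal D(H)$ is the dual Hopf algebra of $\mathcal T(H)$. As a vector space it is identified with $\hat H\otimes H$, where $\omega\bowtie a$ denotes the functional given by $\mathbf p_{\mathcal D}(\omega\bowtie a,\,c^{\mathrm{op}}\otimes\theta)=\omega(c)\,\theta(a)$. Let $\mathbb W\in\mathcal D(H)\otimes\mathcal T(H)$ be the canonical element of the pairing $\mathbf p_{\mathcal D}$. *Heisenberg algebra.* $\mathcal H(\hat H)=\hat H\#H$ is the vector space $\hat H\otimes H$ with product $(\theta\#h)(\theta'\#h')=\theta\,(h_{(1)}\blacktriangleright\theta')\#h_{(2)}h'$, where $(h\blacktriangleright\omega)(x)=\omega(xh)$. Let $\hat\iota_1(\theta)=\theta\#1$ and $\hat\iota_2(h)=1\#h$, and let $\bar L_2:\mathcal D(H)\to\mathcal H(\hat H)$ be the linear isomorphism $\omega\bowtie h\mapsto\omega\#h$. *Yetter–Drinfeld algebras.* For a Hopf algebra $B$, a left (right) coaction of $B$ on a unital algebra $X$ is a coassociative and counital homomorphism of unital algebras $X\to B\otimes X$ (respectively $X\to X\otimes B$); a left action of $B$ on $X$ is a left module structure with $b\rhd(xy)=(b_{(1)}\rhd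 x)(b_{(2)}\rhd y)$ and $b\rhd 1=\varepsilon(b)1$. * $(X,\alpha,\beta)$ is a left-right $(\mathcal D(H),\mathcal T(H))$-Yetter–Drinfeld algebra if $\alpha$ is a left coaction of $\mathcal D(H)$ on $X$, $\beta$ is a right coaction of $\mathcal T(H)$ on $X$, and $(\alpha\otimes\mathrm{id})\beta=\mathrm{Ad}(\mathbb W_{13})(\mathrm{id}\otimes\beta)\alpha$. * $(X,\rhd,\delta)$ is a left-left Yetter–Drinfeld algebra over $\mathcal D(H)$ if $\rhd$ is a left action and $\delta:x\mapsto x_{[-1]}\otimes x_{[0]}$ a left coaction of $\mathcal D(H)$ on $X$, and $d_{(1)}x_{[-1]}\otimes(d_{(2)}\rhd x_{[0]})=(d_{(1)}\rhd x)_{[-1]}d_{(2)}\otimes(d_{(1)}\rhd x)_{[0]}$ for all $d\in\mathcal D(H)$, $x\in X$. **Theorem.** Define $$\Gamma'=(\mathrm{id}\otimes\bar L_2)\,\Delta_{\mathcal D(H)}\,\bar L_2^{-1}:\ \mathcal H(\hat H)\to\mathcal D(H)\otimes\mathcal H(\hat H),\qquad \theta\#h\mapsto(\theta_{(2)}\bowtie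 h_{(1)})\otimes(\theta_{(1)}\#h_{(2)}),$$ $$\Gamma:\ \mathcal H(\hat H)\to\mathcal H(\hat H)\otimes\mathcal T(H),\qquad x\mapsto\mathrm{Ad}(\mathbb V_{12}\mathbb U_{13})(x\otimes1_{\mathcal T(H)}),$$ where $\mathbb U=(\hat\iota_2\otimes\mathrm{id})(U)\in\mathcal H(\hat H)\otimes\hat H$ and $\mathbb V=(\hat\iota_1\otimes\mathrm{id})(\Sigma({}^{\circ}U))\in\mathcal H(\hat H)\otimes H^{\mathrm{op}}$, and let $d\rhd_\Gamma x=(\mathrm{id}\otimes\mathbf p_{\mathcal D}(d,\cdot))(\Gamma(x))$ for $d\in\mathcal D(H)$, $x\in\mathcal H(\hat H)$. Then 1. $(\mathcal H(\hat H),\Gamma',\Gamma)$ is a left-right $(\mathcal D(H),\mathcal T(H))$-Yetter–Drinfeld algebra; 2. $(\mathcal H(\hat H),\rhd_\Gamma,\Gamma')$ is a left-left Yetter–Drinfeld algebra over $\mathcal D(H)$. -/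

import Mathlib

open scoped TensorProduct

namespace HopfYD

open Coalgebra HopfAlgebra WithConv LinearMap

section Antipode
variable {k : Type*} [Field k] {H : Type*} [Ring H] [HopfAlgebra k H]

theorem conv_comul_antipode_left :
    toConv (comul (R := k) (A := H) ∘ₗ antipode k) * toConv (comul (R := k) (A := H)) = 1 := by
  have h := algHom_comp_convMul_distrib (Bialgebra.comulAlgHom k H)
    (toConv (antipode k (A := H))) (toConv (LinearMap.id : H →ₗ[k] H))
  rw [antipode_mul_id] at h
  have h2 := congrArg toConv h
  refine Eq.trans ?_ (h2.symm.trans ?_)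
  · rfl
  · ext a
    simp

theorem conv_incl :
    toConv (Algebra.TensorProduct.includeLeft (R := k) (S := k) (A := H) (B := H)).toLinearMap *
      toConv (Algebra.TensorProduct.includeRight (R := k) (A := H) (B := H)).toLinearMap =
    toConv (comul (R := k) (A := H)) := by
  ext a
  have := (ℛ k a).eq
  simp [(ℛ k a).convMul_apply, this]

theorem conv_inclRight_antipode :
    toConv (Algebra.TensorProduct.includeRight (R := k) (A := H) (B := H)).toLinearMap *
      toConv ((Algebra.TensorProduct.includeRight (R := k) (A := H) (B := H)).toLinearMap ∘ₗ
        antipode k (A := H)) = 1 := by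
  have h := algHom_comp_convMul_distrib (Algebra.TensorProduct.includeRight (R := k) (A := H) (B := H))
    (toConv (LinearMap.id : H →ₗ[k] H)) (toConv (antipode k (A := H)))
  rw [id_mul_antipode] at h
  have h2 := congrArg toConv h
  refine Eq.trans ?_ (h2.symm.trans ?_)
  · rfl
  · ext a
    simp [Algebra.algebraMap_eq_smul_one, Algebra.TensorProduct.one_def]

theorem conv_inclLeft_antipode :
    toConv (Algebra.TensorProduct.includeLeft (R := k) (S := k) (A := H) (B := H)).toLinearMap *
      toConv ((Algebra.TensorProduct.includeLeft (R := k) (S := k) (A := H) (B := H)).toLinearMap ∘ₗ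
        antipode k (A := H)) = 1 := by
  have h := algHom_comp_convMul_distrib (Algebra.TensorProduct.includeLeft (R := k) (S := k) (A := H) (B := H))
    (toConv (LinearMap.id : H →ₗ[k] H)) (toConv (antipode k (A := H)))
  rw [id_mul_antipode] at h
  have h2 := congrArg toConv h
  refine Eq.trans ?_ (h2.symm.trans ?_)
  · rfl
  · ext a
    simp

/-- `1 ⊗ S(h) = Δ(S(h₁)) (h₂ ⊗ 1)` -/
theorem conv_key :
    toConv (comul (R := k) (A := H) ∘ₗ antipode k) *
      toConv (Algebra.TensorProduct.includeLeft (R := k) (S := k) (A := H) (B := H)).toLinearMap =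
    toConv ((Algebra.TensorProduct.includeRight (R := k) (A := H) (B := H)).toLinearMap ∘ₗ
        antipode k (A := H)) := by
  have h1 := conv_comul_antipode_left (k := k) (H := H)
  rw [← conv_incl, ← mul_assoc] at h1
  exact left_inv_eq_right_inv h1 conv_inclRight_antipode

theorem conv_key' :
    toConv (comul (R := k) (A := H) ∘ₗ antipode k) =
    toConv ((Algebra.TensorProduct.includeRight (R := k) (A := H) (B := H)).toLinearMap ∘ₗ
        antipode k (A := H)) *
      toConv ((Algebra.TensorProduct.includeLeft (R := k) (S := k) (A := H) (B := H)).toLinearMap ∘ₗ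
        antipode k (A := H)) := by
  rw [← conv_key, mul_assoc, conv_inclLeft_antipode, mul_one]

/-- The antipode reverses the comultiplication. -/
theorem comul_antipode {ι : Type*} {a : H} (r : Repr k a ι) :
    comul (R := k) (antipode k a) =
      ∑ i ∈ r.index, antipode k (r.right i) ⊗ₜ[k] antipode k (r.left i) := by
  have := congrArg (fun f => f a) (conv_key' (k := k) (H := H))
  simp only [r.convMul_apply] at this
  simpa using this


theorem sweedler_assoc {A M ι : Type*} [AddCommGroup A] [Module k A] [Coalgebra k A]
    [AddCommGroup M] [Module k M] {κ Λ : ι → Type*} {a : A}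
    (F : A →ₗ[k] A →ₗ[k] A →ₗ[k] M) (r : Repr k a ι)
    (a₁ : (i : ι) → Repr k (r.left i) (κ i)) (a₂ : (i : ι) → Repr k (r.right i) (Λ i)) :
    ∑ i ∈ r.index, ∑ j ∈ (a₁ i).index, F ((a₁ i).left j) ((a₁ i).right j) (r.right i) =
    ∑ i ∈ r.index, ∑ j ∈ (a₂ i).index, F (r.left i) ((a₂ i).left j) ((a₂ i).right j) := by
  have := congrArg (TensorProduct.lift ((TensorProduct.uncurry (.id k) A A M) ∘ₗ F))
    (sum_tmul_tmul_eq r a₁ a₂)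
  simpa using this


/-- `y ↦ y₁ f(y₂)` -/
noncomputable def slice (f : H →ₗ[k] k) : H →ₗ[k] H :=
  (TensorProduct.rid k H).toLinearMap ∘ₗ f.lTensor H ∘ₗ comul

/-- `y ↦ g(y₁) y₂` -/
noncomputable def slice' (g : H →ₗ[k] k) : H →ₗ[k] H :=
  (TensorProduct.lid k H).toLinearMap ∘ₗ g.rTensor H ∘ₗ comul

theorem slice_apply {ι : Type*} (f : H →ₗ[k] k) {a : H} (r : Repr k a ι) :
    slice f a = ∑ i ∈ r.index, f (r.right i) • r.left i := by
  simp [slice, ← r.eq]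

theorem slice'_apply {ι : Type*} (f : H →ₗ[k] k) {a : H} (r : Repr k a ι) :
    slice' f a = ∑ i ∈ r.index, f (r.left i) • r.right i := by
  simp [slice', ← r.eq]

theorem comul_slice (f : H →ₗ[k] k) (a : H) :
    comul (R := k) (slice f a) = (slice f).lTensor H (comul a) := by
  have h1 : ((TensorProduct.rid k H).toLinearMap ∘ₗ f.lTensor H).lTensor H ∘ₗ
      (TensorProduct.assoc k H H H).toLinearMap =
      (TensorProduct.rid k (H ⊗[k] H)).toLinearMap ∘ₗ f.lTensor (H ⊗[k] H) := by
    ext x y z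
    simp [TensorProduct.tmul_smul]
  have h2 := LinearMap.congr_fun h1 (comul.rTensor H (comul (R := k) a))
  simp only [LinearMap.comp_apply, LinearEquiv.coe_coe, coassoc_apply] at h2
  have h3 : (TensorProduct.rid k (H ⊗[k] H)).toLinearMap ∘ₗ f.lTensor (H ⊗[k] H) ∘ₗ
      comul.rTensor H = comul ∘ₗ (TensorProduct.rid k H).toLinearMap ∘ₗ f.lTensor H := by
    ext x y
    simp
  have h4 := LinearMap.congr_fun h3 (comul (R := k) a)
  simp only [LinearMap.comp_apply, LinearEquiv.coe_coe] at h4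
  rw [h4, ← LinearMap.comp_apply, ← LinearMap.lTensor_comp] at h2
  exact h2.symm

theorem slice_slice' (f g : H →ₗ[k] k) (a : H) : slice f (slice' g a) = slice' g (slice f a) := by
  have h1 : slice f ∘ₗ (TensorProduct.lid k H).toLinearMap ∘ₗ g.rTensor H =
      (TensorProduct.lid k H).toLinearMap ∘ₗ g.rTensor H ∘ₗ (slice f).lTensor H := by
    ext x y
    simp
  have := LinearMap.congr_fun h1 (comul (R := k) a)
  simp only [LinearMap.comp_apply] at this
  rw [← comul_slice] at this
  exact this

/-- `x ↦ f (x a)` -/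
noncomputable def rshift (f : H →ₗ[k] k) (a : H) : H →ₗ[k] k := f ∘ₗ LinearMap.mulRight k a

theorem rshift_apply (f : H →ₗ[k] k) (a x : H) : rshift f a x = f (x * a) := rfl

/-- `L_g(x) S(h) = L_{g(· h₂)}(x S(h₁))`. -/
theorem slice'_mul_antipode {ι : Type*} (g : H →ₗ[k] k) (x : H) {h : H} (r : Repr k h ι) :
    slice' g x * antipode k h =
      ∑ i ∈ r.index, slice' (rshift g (r.right i)) (x * antipode k (r.left i)) := by
  have h1 := congrArg (fun f => comul (R := k) x * f h) (conv_key (k := k) (H := H))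
  simp only [r.convMul_apply] at h1
  have h2 := congrArg ((TensorProduct.lid k H).toLinearMap ∘ₗ g.rTensor H) h1
  simp only [Finset.mul_sum, ← mul_assoc, map_sum] at h2
  have e1 : ∀ (t : H ⊗[k] H) (b : H), ((TensorProduct.lid k H).toLinearMap ∘ₗ g.rTensor H)
      (t * (1 ⊗ₜ b)) = ((TensorProduct.lid k H).toLinearMap ∘ₗ g.rTensor H) t * b := by
    intro t b
    induction t with
    | zero => simp
    | tmul p q => simp
    | add p q hp hq => simp only [add_mul, map_add, hp, hq]
  have e2 : ∀ (t : H ⊗[k] H) (b : H), ((TensorProduct.lid k H).toLinearMap ∘ₗ g.rTensor H)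
      (t * (b ⊗ₜ 1)) = ((TensorProduct.lid k H).toLinearMap ∘ₗ (rshift g b).rTensor H) t := by
    intro t b
    induction t with
    | zero => simp
    | tmul p q => simp [rshift_apply]
    | add p q hp hq => simp only [add_mul, map_add, hp, hq]
  refine (e1 (comul x) (antipode k h)).symm.trans (h2.symm.trans ?_)
  refine Finset.sum_congr rfl fun i _ => ?_
  refine Eq.trans ?_ (e2 (comul (x * antipode k (r.left i))) (r.right i))
  rw [Bialgebra.comul_mul]
  rfl

theorem antipode_antipode_slice {ι : Type*} (g : H →ₗ[k] k) (x : H) {h : H} (r : Repr k h ι) :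
    slice' g x * antipode k (antipode k h) =
      ∑ i ∈ r.index, slice' (rshift g (antipode k (r.left i)))
        (x * antipode k (antipode k (r.right i))) :=
  slice'_mul_antipode g x (h := antipode k h)
    { index := r.index
      left := fun i => antipode k (r.right i)
      right := fun i => antipode k (r.left i)
      eq := (comul_antipode r).symm }

variable [Module.Finite k H]

/-- `e ↦ g(w(e₂)₁ S(e₁)) w(e₂)₂` -/
noncomputable def twistMap (g : H →ₗ[k] k) : (H →ₗ[k] H) →ₗ[k] H →ₗ[k] H :=
  LinearMap.mk₂ k (fun w e => TensorProduct.lift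
    (LinearMap.mk₂ k (fun a b => slice' (rshift g (antipode k a)) (w b))
      (by
        intro a a' b
        simp only [slice'_apply _ (ℛ k (w b)), rshift_apply, map_add, mul_add, add_smul,
          Finset.sum_add_distrib])
      (by
        intro c a b
        simp only [slice'_apply _ (ℛ k (w b)), rshift_apply, map_smul, mul_smul_comm, smul_assoc,
          Finset.smul_sum])
      (by intro a b b'; simp)
      (by intro c a b; simp)) (comul (R := k) e))
    (by
      intro w w' e
      induction (comul (R := k) e) with
      | zero => simp
      | tmul p q => simp
      | add p q hp hq => simp only [map_add, hp, hq]; abel)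
    (by
      intro c w e
      induction (comul (R := k) e) with
      | zero => simp
      | tmul p q => simp
      | add p q hp hq => simp only [map_add, hp, hq, smul_add])
    (by intro w e e'; simp) (by intro w e e'; simp)

theorem twistMap_apply {ι : Type*} (g : H →ₗ[k] k) (w : H →ₗ[k] H) {e : H} (r : Repr k e ι) :
    twistMap g w e = ∑ i ∈ r.index, slice' (rshift g (antipode k (r.left i))) (w (r.right i)) := by
  simp [twistMap, ← r.eq]


theorem trace_twistMap (g : H →ₗ[k] k) (w : H →ₗ[k] H) :
    LinearMap.trace k H (twistMap g w) = g 1 * LinearMap.trace k H w := by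
  suffices h : (LinearMap.trace k H ∘ₗ twistMap g) ∘ₗ dualTensorHom k H H =
      (g 1 • LinearMap.trace k H) ∘ₗ dualTensorHom k H H by
    obtain ⟨t, rfl⟩ := (dualTensorHom_bijective (R := k) (M := H) (N := H)).2 w
    exact LinearMap.congr_fun h t
  ext φ v
  simp only [TensorProduct.AlgebraTensorModule.curry_apply, TensorProduct.curry_apply,
    LinearMap.comp_apply, LinearMap.restrictScalars_self, LinearMap.smul_apply,
    trace_eq_contract_apply, contractLeft_apply, smul_eq_mul]
  let ψ : H → Module.Dual k H := fun a =>
    (toConv (g ∘ₗ LinearMap.mulLeft k a ∘ₗ antipode k) * toConv φ).ofConv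
  have e1 : twistMap g (dualTensorHom k H H (φ ⊗ₜ v)) =
      dualTensorHom k H H (∑ j ∈ (ℛ k v).index, ψ ((ℛ k v).left j) ⊗ₜ (ℛ k v).right j) := by
    ext e
    rw [twistMap_apply g _ (ℛ k e)]
    simp only [dualTensorHom_apply, map_sum, map_smul, LinearMap.sum_apply,
      slice'_apply _ (ℛ k v), rshift_apply, ψ]
    have : ∀ a, (toConv (g ∘ₗ LinearMap.mulLeft k a ∘ₗ antipode k) * toConv φ).ofConv e =
      ∑ i ∈ (ℛ k e).index, g (a * antipode k ((ℛ k e).left i)) * φ ((ℛ k e).right i) :=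
        fun a => (ℛ k e).convMul_apply _ _
    simp only [this, Finset.smul_sum, Finset.sum_smul, smul_smul]
    rw [Finset.sum_comm]
    simp only [mul_comm]
  rw [e1, trace_eq_contract_apply]
  simp only [map_sum, contractLeft_apply]
  have e2 : ∀ j, ψ ((ℛ k v).left j) ((ℛ k v).right j) =
      ∑ i ∈ (ℛ k ((ℛ k v).right j)).index,
        g ((ℛ k v).left j * antipode k ((ℛ k ((ℛ k v).right j)).left i)) *
          φ ((ℛ k ((ℛ k v).right j)).right i) :=
    fun j => (ℛ k ((ℛ k v).right j)).convMul_apply _ _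
  simp only [e2]
  let F : H →ₗ[k] H →ₗ[k] H →ₗ[k] k := LinearMap.mk₂ k
    (fun a b => (g (a * antipode k b)) • φ)
    (by intro a a' b; simp [add_mul, add_smul]) (by intro c a b; simp [mul_smul])
    (by intro a b b'; simp [mul_add, add_smul]) (by intro c a b; simp [mul_smul])
  have e3 := sweedler_assoc F (ℛ k v) (fun i => ℛ k _) (fun i => ℛ k _)
  simp only [F, mk₂_apply, LinearMap.smul_apply, smul_eq_mul] at e3
  rw [← e3]
  simp only [← Finset.sum_mul, ← map_sum, sum_mul_antipode_eq_algebraMap_counit]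
  have hv : φ v = ∑ i ∈ (ℛ k v).index, counit (R := k) ((ℛ k v).left i) * φ ((ℛ k v).right i) := by
    conv_lhs => rw [← sum_counit_smul (ℛ k v)]
    simp
  rw [hv, Finset.mul_sum]
  refine Finset.sum_congr rfl fun i _ => ?_
  rw [Algebra.algebraMap_eq_smul_one, map_smul, smul_eq_mul]
  ring

/-- `P(f)(x) = Tr (e ↦ y₁ f(y₂))`, where `y = x S²(e)`. -/
noncomputable def integralOf (f : H →ₗ[k] k) : H →ₗ[k] k :=
  LinearMap.trace k H ∘ₗ (LinearMap.mk₂ k (fun x e => slice f (x * antipode k (antipode k e)))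
    (by simp [add_mul]) (by simp) (by simp [mul_add]) (by simp))

def IsIntegral (l : H →ₗ[k] k) : Prop := ∀ (g : H →ₗ[k] k) (x : H), l (slice' g x) = g 1 * l x

theorem integralOf_isIntegral (f : H →ₗ[k] k) : IsIntegral (integralOf f) := by
  intro g x
  rw [integralOf, LinearMap.comp_apply, LinearMap.comp_apply, ← trace_twistMap]
  congr 1
  ext e
  rw [twistMap_apply _ _ (ℛ k e), mk₂_apply, antipode_antipode_slice g x (ℛ k e), map_sum]
  simp only [slice_slice', mk₂_apply]


theorem trace_tensor_eq_sum {ι : Type*} [Fintype ι] [DecidableEq ι] (b : Module.Basis ι k H)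
    (N : H ⊗[k] H →ₗ[k] H ⊗[k] H) :
    LinearMap.trace k (H ⊗[k] H) N = ∑ j, LinearMap.trace k H
      ((TensorProduct.rid k H).toLinearMap ∘ₗ (b.coord j).lTensor H ∘ₗ N ∘ₗ
        (TensorProduct.mk k H H).flip (b j)) := by
  rw [trace_eq_matrix_trace k (b.tensorProduct b)]
  simp only [trace_eq_matrix_trace k b, Matrix.trace, Matrix.diag, toMatrix_apply]
  rw [Fintype.sum_prod_type, Finset.sum_comm]
  refine Finset.sum_congr rfl fun j _ => Finset.sum_congr rfl fun i _ => ?_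
  simp only [Module.Basis.tensorProduct_apply, LinearMap.comp_apply, LinearMap.flip_apply,
    TensorProduct.mk_apply, LinearEquiv.coe_coe]
  induction N (b i ⊗ₜ b j) with
  | zero => simp
  | tmul p q => simp [Module.Basis.tensorProduct_repr_tmul_apply, mul_comm]
  | add p q hp hq => simp only [map_add, Finsupp.add_apply, hp, hq]

theorem exists_integral_ne_zero [Nontrivial H] : ∃ l : H →ₗ[k] k, IsIntegral l ∧ l ≠ 0 := by
  by_contra! hc
  have hz : ∀ f : H →ₗ[k] k, integralOf f = 0 := fun f => hc _ (integralOf_isIntegral f)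
  have key : ∀ (f : H →ₗ[k] k) (x : H), f x = 0 := by
    intro f x
    let m : H ⊗[k] H →ₗ[k] H := LinearMap.mulLeft k x ∘ₗ antipode k ∘ₗ LinearMap.mul' k H ∘ₗ
      (antipode k).rTensor H
    have hm : ∀ a b, m (a ⊗ₜ b) = (x * antipode k b) * antipode k (antipode k a) := by
      intro a b
      simp [m, HopfAlgebra.antipode_mul_antidistrib, mul_assoc]
    let n : H →ₗ[k] H ⊗[k] H := (slice f).lTensor H ∘ₗ comul
    have h1 : LinearMap.trace k (H ⊗[k] H) (n ∘ₗ m) = 0 := by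
      rw [trace_tensor_eq_sum (Module.finBasis k H)]
      refine Finset.sum_eq_zero fun j _ => ?_
      have := LinearMap.congr_fun
        (hz ((Module.finBasis k H).coord j ∘ₗ slice f)) (x * antipode k (Module.finBasis k H j))
      refine Eq.trans ?_ this
      rw [integralOf, LinearMap.comp_apply]
      congr 1
      ext a
      simp only [LinearMap.comp_apply, LinearMap.flip_apply, TensorProduct.mk_apply, hm,
        mk₂_apply, n]
      rw [← LinearMap.comp_apply (LinearMap.lTensor _ _) (LinearMap.lTensor _ _), ← LinearMap.lTensor_comp]
      rfl
    have h2 : m ∘ₗ n = dualTensorHom k H H (f ⊗ₜ x) := by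
      ext y
      simp only [LinearMap.comp_apply, n, dualTensorHom_apply]
      rw [← comul_slice, ← (ℛ k (slice f y)).eq]
      simp only [map_sum, m, LinearMap.comp_apply, LinearMap.rTensor_tmul, LinearMap.mul'_apply]
      rw [← map_sum, ← map_sum, sum_antipode_mul_eq_algebraMap_counit]
      have : counit (R := k) (slice f y) = f y := by
        rw [slice_apply f (ℛ k y)]
        conv_rhs => rw [← sum_counit_smul (ℛ k y)]
        simp [mul_comm]
      simp [this, Algebra.algebraMap_eq_smul_one]
    rw [LinearMap.trace_comp_comm', h2, trace_eq_contract_apply, contractLeft_apply] at h1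
    exact h1
  obtain ⟨x, hx⟩ := exists_ne (0 : H)
  exact hx ((Module.forall_dual_apply_eq_zero_iff k x).mp fun f => key f x)

theorem antipode_injective : Function.Injective (antipode k (A := H)) := by
  rw [injective_iff_map_eq_zero]
  intro h hh
  cases subsingleton_or_nontrivial H
  · exact Subsingleton.elim _ _
  obtain ⟨l, hl, hl0⟩ := exists_integral_ne_zero (k := k) (H := H)
  -- `l(x S(h₁)) h₂ = 0` for all `x`
  let Φ : H →ₗ[k] Module.Dual k H := LinearMap.mk₂ k (fun a x => l (x * antipode k a))
    (by simp [mul_add]) (by simp) (by simp [add_mul]) (by simp)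
  have h1 : Φ.rTensor H (comul h) = 0 := by
    apply (dualTensorHom_bijective (R := k) (M := H) (N := H)).1
    ext x
    rw [map_zero, LinearMap.zero_apply, ← (ℛ k h).eq]
    simp only [map_sum, LinearMap.rTensor_tmul, LinearMap.sum_apply, dualTensorHom_apply]
    rw [← sub_eq_zero, sub_zero]
    apply (Module.forall_dual_apply_eq_zero_iff k _).mp
    intro g
    have := congrArg l (slice'_mul_antipode g x (ℛ k h))
    rw [hh, mul_zero, map_zero, map_sum] at this
    simp only [hl _ _, rshift_apply, one_mul] at this
    rw [map_sum, this]
    refine Finset.sum_congr rfl fun i _ => ?_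
    simp [Φ, mul_comm]
  have h2 : ∀ x, l x • h = 0 := by
    intro x
    let Θ : Module.Dual k H →ₗ[k] H →ₗ[k] H := LinearMap.mk₂ k
      (fun f z => slice' (f ∘ₗ LinearMap.mulLeft k x ∘ₗ antipode k ∘ₗ antipode k) z)
      (by intro f f' z; simp [slice'_apply _ (ℛ k z), add_smul, Finset.sum_add_distrib])
      (by intro c f z; simp [slice'_apply _ (ℛ k z), mul_smul, Finset.smul_sum])
      (by simp) (by simp)
    have h3 := congrArg (TensorProduct.lift Θ) h1
    rw [map_zero, ← (ℛ k h).eq] at h3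
    simp only [map_sum, LinearMap.rTensor_tmul, TensorProduct.lift.tmul, Θ, mk₂_apply] at h3
    simp only [fun (g : H →ₗ[k] k) i => slice'_apply g (ℛ k ((ℛ k h).right i))] at h3
    let F : H →ₗ[k] H →ₗ[k] H →ₗ[k] H := LinearMap.mk₂ k
      (fun a b => (l (x * antipode k (antipode k b) * antipode k a)) • LinearMap.id)
      (by intro a a' b; simp [mul_add, add_smul]) (by intro c a b; simp [mul_smul])
      (by intro a b b'; simp [mul_add, add_mul, add_smul]) (by intro c a b; simp [mul_smul])
    have h4 := sweedler_assoc F (ℛ k h) (fun i => ℛ k _) (fun i => ℛ k _)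
    simp only [F, mk₂_apply, LinearMap.smul_apply, LinearMap.id_apply, mul_assoc,
      ← HopfAlgebra.antipode_mul_antidistrib] at h4
    simp only [Φ, mk₂_apply, LinearMap.comp_apply, LinearMap.mulLeft_apply, mul_assoc,
      ← HopfAlgebra.antipode_mul_antidistrib] at h3
    rw [h3] at h4
    simp only [← Finset.sum_smul, ← map_sum, ← Finset.mul_sum,
      sum_mul_antipode_eq_algebraMap_counit] at h4
    rw [← h4]
    conv_lhs => rw [← sum_counit_smul (ℛ k h)]
    rw [Finset.smul_sum]
    refine Finset.sum_congr rfl fun i _ => ?_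
    simp [Algebra.algebraMap_eq_smul_one, mul_smul, smul_comm (l x)]
  obtain ⟨x, hx⟩ : ∃ x, l x ≠ 0 := by
    by_contra! hc
    exact hl0 (LinearMap.ext hc)
  exact (smul_eq_zero.mp (h2 x)).resolve_left hx

end Antipode

section Opposite
variable {k : Type*} [Field k] {H : Type*} [Ring H] [HopfAlgebra k H]

noncomputable instance instBialgebraOp : Bialgebra k Hᵐᵒᵖ :=
  Bialgebra.mk' k Hᵐᵒᵖ
    (by simp [MulOpposite.counit_def])
    (by intro a b; simp [MulOpposite.counit_def, mul_comm])
    (by simp [MulOpposite.comul_def, Algebra.TensorProduct.one_def])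
    (by
      intro a b
      have h : ∀ s t : H ⊗[k] H, TensorProduct.map (MulOpposite.opLinearEquiv k).toLinearMap
          (MulOpposite.opLinearEquiv k).toLinearMap (s * t) =
          TensorProduct.map (MulOpposite.opLinearEquiv k).toLinearMap
            (MulOpposite.opLinearEquiv k).toLinearMap t *
          TensorProduct.map (MulOpposite.opLinearEquiv k).toLinearMap
            (MulOpposite.opLinearEquiv k).toLinearMap s := by
        intro s t
        induction s with
        | zero => simp
        | add p q hp hq => simp only [add_mul, mul_add, map_add, hp, hq]
        | tmul p q =>
          induction t with
          | zero => simp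
          | add p q hp hq => simp only [add_mul, mul_add, map_add, hp, hq]
          | tmul p q => simp
      simp [MulOpposite.comul_def, Bialgebra.comul_mul, h])

variable [Module.Finite k H]

variable (k H) in
/-- The inverse of the (automatically bijective) antipode. -/
noncomputable def antipodeInv : H →ₗ[k] H :=
  (LinearEquiv.ofInjectiveEndo (antipode k (A := H)) antipode_injective).symm.toLinearMap

@[simp] theorem antipode_antipodeInv (a : H) : antipode k (antipodeInv k H a) = a :=
  (LinearEquiv.ofInjectiveEndo (antipode k (A := H)) antipode_injective).apply_symm_apply a

@[simp] theorem antipodeInv_antipode (a : H) : antipodeInv k H (antipode k a) = a :=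
  (LinearEquiv.ofInjectiveEndo (antipode k (A := H)) antipode_injective).symm_apply_apply a

theorem sum_antipodeInv_mul {ι : Type*} {a : H} (r : Repr k a ι) :
    ∑ i ∈ r.index, antipodeInv k H (r.right i) * r.left i = algebraMap k H (counit a) := by
  apply antipode_injective (k := k) (H := H)
  simp only [map_sum, antipode_mul_antidistrib, antipode_antipodeInv,
    sum_antipode_mul_eq_algebraMap_counit, Algebra.algebraMap_eq_smul_one, map_smul, antipode_one]

theorem sum_mul_antipodeInv {ι : Type*} {a : H} (r : Repr k a ι) :
    ∑ i ∈ r.index, r.right i * antipodeInv k H (r.left i) = algebraMap k H (counit a) := by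
  apply antipode_injective (k := k) (H := H)
  simp only [map_sum, antipode_mul_antidistrib, antipode_antipodeInv,
    sum_mul_antipode_eq_algebraMap_counit, Algebra.algebraMap_eq_smul_one, map_smul, antipode_one]

/-- The opposite Hopf algebra; its antipode is the inverse of the antipode. -/
noncomputable instance instHopfAlgebraOp : HopfAlgebra k Hᵐᵒᵖ where
  antipode := (MulOpposite.opLinearEquiv k).toLinearMap ∘ₗ antipodeInv k H ∘ₗ
    (MulOpposite.opLinearEquiv k).symm.toLinearMap
  mul_antipode_rTensor_comul := by
    ext a
    have h := congrArg MulOpposite.op (sum_mul_antipodeInv (k := k) (ℛ k a.unop))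
    simp only [MulOpposite.comul_def, MulOpposite.counit_def, LinearMap.comp_apply,
      LinearEquiv.coe_coe, MulOpposite.coe_opLinearEquiv_symm, ← (ℛ k a.unop).eq]
    simpa using h
  mul_antipode_lTensor_comul := by
    ext a
    have h := congrArg MulOpposite.op (sum_antipodeInv_mul (k := k) (ℛ k a.unop))
    simp only [MulOpposite.comul_def, MulOpposite.counit_def, LinearMap.comp_apply,
      LinearEquiv.coe_coe, MulOpposite.coe_opLinearEquiv_symm, ← (ℛ k a.unop).eq]
    simpa using h

end Opposite


section Dual
variable {k : Type*} [Field k]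

variable (k) in
/-- The dual algebra of a coalgebra `C`: linear functionals with the convolution product. -/
def HDual (C : Type*) [AddCommGroup C] [Module k C] [Coalgebra k C] : Type _ := WithConv (C →ₗ[k] k)

variable {C D E : Type*} [AddCommGroup C] [Module k C] [Coalgebra k C] [AddCommGroup D]
    [Module k D] [Coalgebra k D] [AddCommGroup E] [Module k E] [Coalgebra k E]

noncomputable instance instRingHDual : Ring (HDual k C) := inferInstanceAs (Ring (WithConv (C →ₗ[k] k)))

noncomputable instance instAlgebraHDual : Algebra k (HDual k C) :=
  inferInstanceAs (Algebra k (WithConv (C →ₗ[k] k)))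

variable (k C) in
/-- An element of the dual, as a functional: `ev k C θ x = θ(x)`. -/
noncomputable def ev : HDual k C ≃ₗ[k] (C →ₗ[k] k) := WithConv.linearEquiv k (C →ₗ[k] k)

theorem dual_ext {f g : HDual k C} (h : ∀ x, ev k C f x = ev k C g x) : f = g :=
  (ev k C).injective (LinearMap.ext h)

theorem ev_mul (f g : HDual k C) (x : C) : ev k C (f * g) x =
    LinearMap.mul' k k (TensorProduct.map (ev k C f) (ev k C g) (comul x)) := rfl

theorem ev_mul_repr {ι : Type*} {x : C} (r : Repr k x ι) (f g : HDual k C) : ev k C (f * g) x =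
    ∑ i ∈ r.index, ev k C f (r.left i) * ev k C g (r.right i) := by
  simp [ev_mul, ← r.eq]

@[simp] theorem ev_one (x : C) : ev k C 1 x = counit x := rfl

instance instFiniteHDual [Module.Finite k C] : Module.Finite k (HDual k C) :=
  Module.Finite.equiv (ev k C).symm

variable [Module.Finite k C] [Module.Finite k D] [Module.Finite k E]

variable (k C D) in
/-- The pairing of `Ĉ ⊗ D̂` with `C ⊗ D`. -/
noncomputable def ev₂ : HDual k C ⊗[k] HDual k D ≃ₗ[k] (C ⊗[k] D →ₗ[k] k) :=
  (TensorProduct.congr (ev k C) (ev k D)).trans (TensorProduct.dualDistribEquiv k C D)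

@[simp] theorem ev₂_tmul (f : HDual k C) (g : HDual k D) (x : C) (y : D) :
    ev₂ k C D (f ⊗ₜ g) (x ⊗ₜ y) = ev k C f x * ev k D g y := by
  simp [ev₂]

theorem ev₂_ext {s t : HDual k C ⊗[k] HDual k D}
    (h : ∀ x y, ev₂ k C D s (x ⊗ₜ y) = ev₂ k C D t (x ⊗ₜ y)) : s = t := by
  apply (ev₂ k C D).injective
  ext x y
  exact h x y

variable (k C D E) in
noncomputable def ev₃ : HDual k C ⊗[k] (HDual k D ⊗[k] HDual k E) ≃ₗ[k]
    (C ⊗[k] (D ⊗[k] E) →ₗ[k] k) :=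
  (TensorProduct.congr (ev k C) (ev₂ k D E)).trans (TensorProduct.dualDistribEquiv k C (D ⊗[k] E))

@[simp] theorem ev₃_tmul (f : HDual k C) (g : HDual k D ⊗[k] HDual k E) (x : C) (y : D ⊗[k] E) :
    ev₃ k C D E (f ⊗ₜ g) (x ⊗ₜ y) = ev k C f x * ev₂ k D E g y := by
  simp [ev₃]

theorem ev₃_ext {s t : HDual k C ⊗[k] (HDual k D ⊗[k] HDual k E)}
    (h : ∀ x y z, ev₃ k C D E s (x ⊗ₜ (y ⊗ₜ z)) = ev₃ k C D E t (x ⊗ₜ (y ⊗ₜ z))) :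
    s = t := by
  apply (ev₃ k C D E).injective
  ext x y z
  exact h x y z

theorem ev₂_mul (s t : HDual k C ⊗[k] HDual k D) (x : C ⊗[k] D) :
    ev₂ k C D (s * t) x =
      LinearMap.mul' k k (TensorProduct.map (ev₂ k C D s) (ev₂ k C D t)
        (comul (R := k) (A := C ⊗[k] D) x)) := by
  induction s with
  | zero => simp
  | add p q hp hq => simp only [add_mul, map_add, LinearMap.add_apply, TensorProduct.map_add_left, hp, hq]
  | tmul p q =>
    induction t with
    | zero => simp
    | add p q hp hq => simp only [mul_add, map_add, LinearMap.add_apply, TensorProduct.map_add_right, hp, hq]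
    | tmul p' q' =>
      induction x with
      | zero => simp
      | add x y hx hy => simp only [map_add, hx, hy]
      | tmul x y =>
        simp only [Algebra.TensorProduct.tmul_mul_tmul, ev₂_tmul, ev_mul_repr (ℛ k x),
          ev_mul_repr (ℛ k y), TensorProduct.comul_tmul, ← (ℛ k x).eq, ← (ℛ k y).eq,
          TensorProduct.sum_tmul, TensorProduct.tmul_sum, map_sum, Finset.sum_mul_sum]
        refine (Finset.sum_congr rfl fun i _ => Finset.sum_congr rfl fun j _ => ?_).trans
          Finset.sum_comm
        simp
        ring

end Dual

section DualHopf
variable {k : Type*} [Field k] {H : Type*} [Ring H]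

section
variable [Bialgebra k H] [Module.Finite k H]

noncomputable instance instCoalgebraStructHDual : CoalgebraStruct k (HDual k H) where
  comul := (ev₂ k H H).symm.toLinearMap ∘ₗ LinearMap.lcomp k k (LinearMap.mul' k H) ∘ₗ
    (ev k H).toLinearMap
  counit := LinearMap.applyₗ 1 ∘ₗ (ev k H).toLinearMap

@[simp] theorem dual_counit (f : HDual k H) : counit (R := k) f = ev k H f 1 := rfl

@[simp] theorem ev₂_comul (f : HDual k H) (t : H ⊗[k] H) :
    ev₂ k H H (comul (R := k) f) t = ev k H f (LinearMap.mul' k H t) := by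
  simp only [comul, LinearMap.comp_apply, LinearEquiv.coe_coe, LinearEquiv.apply_symm_apply]
  rfl

theorem dual_comul_repr {ι : Type*} {f : HDual k H} (r : Repr k f ι) (x y : H) :
    ∑ i ∈ r.index, ev k H (r.left i) x * ev k H (r.right i) y = ev k H f (x * y) := by
  rw [← LinearMap.mul'_apply (R := k), ← ev₂_comul, ← r.eq]
  simp

noncomputable instance instCoalgebraHDual : Coalgebra k (HDual k H) where
  coassoc := by
    ext f : 1
    refine ev₃_ext fun x y z => ?_
    simp only [LinearMap.comp_apply]
    have h1 : ∀ t : HDual k H ⊗[k] HDual k H,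
      ev₃ k H H H (comul.lTensor (HDual k H) t) (x ⊗ₜ (y ⊗ₜ z)) = ev₂ k H H t (x ⊗ₜ (y * z)) := by
      intro t
      induction t with
      | zero => simp
      | add p q hp hq => simp only [map_add, LinearMap.add_apply, hp, hq]
      | tmul p q => simp
    have h2 : ∀ t : HDual k H ⊗[k] HDual k H,
      ev₃ k H H H (TensorProduct.assoc k _ _ _ (comul.rTensor (HDual k H) t)) (x ⊗ₜ (y ⊗ₜ z)) =
          ev₂ k H H t ((x * y) ⊗ₜ z) := by
      intro t
      induction t with
      | zero => simp
      | add p q hp hq => simp only [map_add, LinearMap.add_apply, hp, hq]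
      | tmul p q =>
        rw [ev₂_tmul, ← dual_comul_repr (ℛ k p), LinearMap.rTensor_tmul, ← (ℛ k p).eq]
        simp [TensorProduct.sum_tmul, mul_assoc, Finset.sum_mul]
    refine (h2 _).trans (Eq.trans ?_ (h1 _).symm)
    simp [mul_assoc]
  rTensor_counit_comp_comul := by
    ext f : 1
    apply (TensorProduct.lid k _).injective
    refine dual_ext fun x => ?_
    simpa [← (ℛ k f).eq] using dual_comul_repr (ℛ k f) 1 x
  lTensor_counit_comp_comul := by
    ext f : 1
    apply (TensorProduct.rid k _).injective
    refine dual_ext fun x => ?_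
    simpa [← (ℛ k f).eq, mul_comm] using dual_comul_repr (ℛ k f) x 1

noncomputable instance instBialgebraHDual : Bialgebra k (HDual k H) :=
  Bialgebra.mk' k (HDual k H) (by simp) (by intro a b; simp [ev_mul, Algebra.TensorProduct.one_def])
    (by
      refine ev₂_ext fun x y => ?_
      rw [Algebra.TensorProduct.one_def]
      simp)
    (by
      intro a b
      refine ev₂_ext fun x y => ?_
      rw [ev₂_mul]
      simp only [ev₂_comul]
      have h := CoalgHomClass.map_comp_comul_apply (R := k) (Bialgebra.mulCoalgHom k H) (x ⊗ₜ[k] y)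
      rw [ev_mul]
      rw [show comul (R := k) (mul' k H (x ⊗ₜ[k] y)) = _ from h.symm]
      rw [← LinearMap.comp_apply (TensorProduct.map _ _) (TensorProduct.map _ _), ← TensorProduct.map_comp]
      congr 2
      congr 1
      · ext; simp
      · ext; simp)
end

variable [HopfAlgebra k H] [Module.Finite k H]

variable (k H) in
noncomputable def dualAntipode : HDual k H →ₗ[k] HDual k H :=
  (ev k H).symm.toLinearMap ∘ₗ LinearMap.lcomp k k (antipode k (A := H)) ∘ₗ (ev k H).toLinearMap

@[simp] theorem ev_dualAntipode (f : HDual k H) (x : H) :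
    ev k H (dualAntipode k H f) x = ev k H f (antipode k x) := by
  simp [dualAntipode]

noncomputable instance instHopfAlgebraHDual : HopfAlgebra k (HDual k H) where
  antipode := dualAntipode k H
  mul_antipode_rTensor_comul := by
    ext f : 1
    refine dual_ext fun x => ?_
    have h : ∀ t : HDual k H ⊗[k] HDual k H,
        ev k H (LinearMap.mul' k _ ((dualAntipode k H).rTensor _ t)) x =
          ∑ i ∈ (ℛ k x).index, ev₂ k H H t (antipode k ((ℛ k x).left i) ⊗ₜ (ℛ k x).right i) := by
      intro t
      induction t with
      | zero => simp
      | add p q hp hq => simp only [map_add, LinearMap.add_apply, hp, hq, Finset.sum_add_distrib]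
      | tmul p q => simp [ev_mul_repr (ℛ k x)]
    refine (h _).trans ?_
    simp only [ev₂_comul, LinearMap.mul'_apply, ← map_sum, sum_antipode_mul_eq_algebraMap_counit]
    simp [Algebra.algebraMap_eq_smul_one, mul_comm]
  mul_antipode_lTensor_comul := by
    ext f : 1
    refine dual_ext fun x => ?_
    have h : ∀ t : HDual k H ⊗[k] HDual k H,
        ev k H (LinearMap.mul' k _ ((dualAntipode k H).lTensor _ t)) x =
          ∑ i ∈ (ℛ k x).index, ev₂ k H H t ((ℛ k x).left i ⊗ₜ antipode k ((ℛ k x).right i)) := by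
      intro t
      induction t with
      | zero => simp
      | add p q hp hq => simp only [map_add, LinearMap.add_apply, hp, hq, Finset.sum_add_distrib]
      | tmul p q => simp [ev_mul_repr (ℛ k x)]
    refine (h _).trans ?_
    simp only [ev₂_comul, LinearMap.mul'_apply, ← map_sum, sum_mul_antipode_eq_algebraMap_counit]
    simp [Algebra.algebraMap_eq_smul_one, mul_comm]

end DualHopf

section Canonical
variable {k : Type*} [Field k] {C : Type*} [AddCommGroup C] [Module k C] [Coalgebra k C]
  {X Y : Type*} [Ring X] [Algebra k X] [Ring Y] [Algebra k Y]

/-- `x ⊗ θ ↦ (c ↦ θ(c) x)` -/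
noncomputable def toHom (k C X : Type*) [Field k] [AddCommGroup C] [Module k C] [Coalgebra k C]
    [Ring X] [Algebra k X] : X ⊗[k] HDual k C →ₗ[k] (C →ₗ[k] X) :=
  TensorProduct.lift ((LinearMap.mk₂ k (fun x θ => (ev k C θ).smulRight x)
    (by intros; ext; simp) (by intro c x θ; ext y; exact smul_comm (ev k C θ y) c x)
    (by intros; ext; simp [add_smul]) (by intros; ext; simp [mul_smul])))

@[simp] theorem toHom_tmul (x : X) (θ : HDual k C) (c : C) :
    toHom k C X (x ⊗ₜ θ) c = ev k C θ c • x := by simp [toHom]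

theorem toHom_mul (s t : X ⊗[k] HDual k C) {ι : Type*} {c : C} (r : Repr k c ι) :
    toHom k C X (s * t) c =
      ∑ i ∈ r.index, toHom k C X s (r.left i) * toHom k C X t (r.right i) := by
  induction s with
  | zero => simp
  | add p q hp hq =>
    simp only [add_mul, map_add, LinearMap.add_apply, hp, hq, Finset.sum_add_distrib]
  | tmul p q =>
    induction t with
    | zero => simp
    | add p q hp hq =>
      simp only [mul_add, map_add, LinearMap.add_apply, hp, hq, Finset.sum_add_distrib]
    | tmul p' q' =>
      simp only [Algebra.TensorProduct.tmul_mul_tmul, toHom_tmul, ev_mul_repr r, Finset.sum_smul]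
      refine Finset.sum_congr rfl fun i _ => ?_
      rw [smul_mul_smul_comm]

@[simp] theorem toHom_one (c : C) : toHom k C X 1 c = algebraMap k X (counit c) := by
  simp [Algebra.TensorProduct.one_def, Algebra.algebraMap_eq_smul_one]

theorem toHom_rTensor (g : X →ₗ[k] Y) (t : X ⊗[k] HDual k C) (c : C) :
    toHom k C Y (g.rTensor _ t) c = g (toHom k C X t c) := by
  induction t with
  | zero => simp
  | add p q hp hq => simp only [map_add, LinearMap.add_apply, hp, hq]
  | tmul p q => simp

theorem toHom_tmul_one_mul (x : X) (t : X ⊗[k] HDual k C) (c : C) :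
    toHom k C X ((x ⊗ₜ 1) * t) c = x * toHom k C X t c := by
  induction t with
  | zero => simp
  | add p q hp hq => simp only [mul_add, map_add, LinearMap.add_apply, hp, hq]
  | tmul p q => simp

variable [Module.Finite k C]

theorem toHom_bijective : Function.Bijective (toHom k C X) := by
  have : toHom k C X = (dualTensorHomEquiv k C X).toLinearMap ∘ₗ
      (TensorProduct.congr (ev k C) (LinearEquiv.refl k X)).toLinearMap ∘ₗ
      (TensorProduct.comm k X (HDual k C)).toLinearMap := by
    ext
    simp [dualTensorHomEquiv]
  rw [this]
  simp only [LinearMap.coe_comp, LinearEquiv.coe_coe]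
  exact (dualTensorHomEquiv k C X).bijective.comp
    ((LinearEquiv.bijective _).comp (LinearEquiv.bijective _))

theorem toHom_ext {s t : X ⊗[k] HDual k C} (h : ∀ c, toHom k C X s c = toHom k C X t c) : s = t :=
  toHom_bijective.1 (LinearMap.ext h)

/-- The element `∑ f(cᵢ) ⊗ cⁱ` of `X ⊗ Ĉ` given by a linear map `f : C → X`, for dual bases
`(cᵢ)`, `(cⁱ)`. -/
noncomputable def canonicalElement (f : C →ₗ[k] X) : X ⊗[k] HDual k C :=
  ∑ i, f (Module.finBasis k C i) ⊗ₜ (ev k C).symm ((Module.finBasis k C).coord i)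

@[simp] theorem toHom_canonicalElement (f : C →ₗ[k] X) (c : C) :
    toHom k C X (canonicalElement f) c = f c := by
  simp only [canonicalElement, map_sum, LinearMap.sum_apply, toHom_tmul, LinearEquiv.apply_symm_apply]
  have := congrArg f ((Module.finBasis k C).sum_repr c)
  rw [map_sum] at this
  simpa only [map_smul, Module.Basis.coord_apply] using this

/-- The invertible element of `X ⊗ Ĉ` given by a linear map with a convolution inverse. -/
noncomputable def canonicalUnit (f g : C →ₗ[k] X) (h₁ : toConv f * toConv g = 1)
    (h₂ : toConv g * toConv f = 1) : (X ⊗[k] HDual k C)ˣ where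
  val := canonicalElement f
  inv := canonicalElement g
  val_inv := toHom_ext fun c => by
    have := congrArg (fun f => f c) h₁
    simp only [(ℛ k c).convMul_apply] at this
    simpa [toHom_mul _ _ (ℛ k c)] using this
  inv_val := toHom_ext fun c => by
    have := congrArg (fun f => f c) h₂
    simp only [(ℛ k c).convMul_apply] at this
    simpa [toHom_mul _ _ (ℛ k c)] using this

end Canonical

section CanU
variable (k : Type*) [Field k] (H : Type*) [Ring H] [HopfAlgebra k H] [Module.Finite k H]

/-- The canonical element `U = ∑ hᵢ ⊗ hⁱ` of `H ⊗ Ĥ`, with inverse `(S ⊗ id)(U)`. -/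
noncomputable def canU : (H ⊗[k] HDual k H)ˣ :=
  canonicalUnit LinearMap.id (antipode k) id_mul_antipode antipode_mul_id

/-- The element `°U = (op ⊗ id)(U)` of `Hᵒᵖ ⊗ Ĥ`, with inverse `(op ∘ S⁻¹ ⊗ id)(U)`. -/
noncomputable def opU : (Hᵐᵒᵖ ⊗[k] HDual k H)ˣ :=
  canonicalUnit (MulOpposite.opLinearEquiv k).toLinearMap
    ((MulOpposite.opLinearEquiv k).toLinearMap ∘ₗ antipodeInv k H)
    (by
      ext a
      have h := congrArg MulOpposite.op (sum_antipodeInv_mul (k := k) (ℛ k a))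
      simp only [(ℛ k a).convMul_apply]
      simpa using h)
    (by
      ext a
      have h := congrArg MulOpposite.op (sum_mul_antipodeInv (k := k) (ℛ k a))
      simp only [(ℛ k a).convMul_apply]
      simpa using h)


variable {k H}

@[simp] theorem toHom_opU (h : H) : toHom k H Hᵐᵒᵖ (opU k H : Hᵐᵒᵖ ⊗[k] HDual k H) h = MulOpposite.op h := by
  simp [opU, canonicalUnit]

@[simp] theorem toHom_opU_inv (h : H) : toHom k H Hᵐᵒᵖ (↑(opU k H)⁻¹ : Hᵐᵒᵖ ⊗[k] HDual k H) h =
    MulOpposite.op (antipodeInv k H h) := by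
  simp [opU, canonicalUnit]

end CanU

section Bicharacter
variable {k : Type*} [Field k] {A T : Type*} [Ring A] [Ring T] [HopfAlgebra k A] [HopfAlgebra k T]

variable (k A T) in
/-- `a ⊗ t ↦ a ⊗ 1 ⊗ t` -/
noncomputable def leg13 : A ⊗[k] T →ₐ[k] A ⊗[k] (T ⊗[k] T) :=
  Algebra.TensorProduct.map (AlgHom.id k A) Algebra.TensorProduct.includeRight

variable (k A T) in
/-- `a ⊗ t ↦ a ⊗ t ⊗ 1` -/
noncomputable def leg12 : A ⊗[k] T →ₐ[k] A ⊗[k] (T ⊗[k] T) :=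
  Algebra.TensorProduct.map (AlgHom.id k A) Algebra.TensorProduct.includeLeft

variable (k A T) in
/-- `a ⊗ t ↦ (a ⊗ 1) ⊗ t` -/
noncomputable def leg13' : A ⊗[k] T →ₐ[k] (A ⊗[k] A) ⊗[k] T :=
  Algebra.TensorProduct.map Algebra.TensorProduct.includeLeft (AlgHom.id k T)

variable (k A T) in
/-- `a ⊗ t ↦ (1 ⊗ a) ⊗ t` -/
noncomputable def leg23' : A ⊗[k] T →ₐ[k] (A ⊗[k] A) ⊗[k] T :=
  Algebra.TensorProduct.map Algebra.TensorProduct.includeRight (AlgHom.id k T)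

/-- `R` is a Hopf copairing: `(Δ ⊗ id)R = R₁₃R₂₃`, `(id ⊗ Δ)R = R₁₃R₁₂` (and the consequences of
these that are used below). An auxiliary notion, applied to `°U` only. -/
structure IsBicharacter (R : (A ⊗[k] T)ˣ) : Prop where
  comul_left : (comul (R := k) (A := A)).rTensor T (R : A ⊗[k] T) =
    leg13' k A T R * leg23' k A T R
  comul_right : (comul (R := k) (A := T)).lTensor A (R : A ⊗[k] T) =
    leg13 k A T R * leg12 k A T R
  counit_left : TensorProduct.lid k T ((counit (R := k) (A := A)).rTensor T (R : A ⊗[k] T)) = 1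
  counit_right : TensorProduct.rid k A ((counit (R := k) (A := T)).lTensor A (R : A ⊗[k] T)) = 1
  antipode_left : (antipode k (A := A)).rTensor T (R : A ⊗[k] T) = (↑R⁻¹ : A ⊗[k] T)
  antipode_antipode : (antipode k (A := T)).lTensor A (↑R⁻¹ : A ⊗[k] T) = R

end Bicharacter

section
variable {k : Type*} [Field k] {H : Type*} [Ring H] [HopfAlgebra k H] [Module.Finite k H]

theorem opU_isBicharacter : IsBicharacter (opU k H) where
  comul_left := by
    refine toHom_ext fun h => ?_
    have e1 : ∀ t, leg13' k Hᵐᵒᵖ (HDual k H) t =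
      (Algebra.TensorProduct.includeLeft (R := k) (S := k) (A := Hᵐᵒᵖ) (B := Hᵐᵒᵖ)).toLinearMap.rTensor _ t :=
      fun t => rfl
    have e2 : ∀ t, leg23' k Hᵐᵒᵖ (HDual k H) t =
      (Algebra.TensorProduct.includeRight (R := k) (A := Hᵐᵒᵖ) (B := Hᵐᵒᵖ)).toLinearMap.rTensor _ t :=
      fun t => rfl
    rw [toHom_mul _ _ (ℛ k h), e1, e2]
    simp only [toHom_rTensor, toHom_opU, MulOpposite.comul_def, LinearMap.comp_apply]
    simp [← (ℛ k h).eq]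
  comul_right := by
    have key : ∀ t : Hᵐᵒᵖ ⊗[k] HDual k H, ∀ x y : H,
       toHom k H Hᵐᵒᵖ (toHom k H (Hᵐᵒᵖ ⊗[k] HDual k H) ((TensorProduct.assoc k _ _ _).symm
        ((comul (R := k) (A := HDual k H)).lTensor Hᵐᵒᵖ t)) y) x = toHom k H Hᵐᵒᵖ t (x * y) := by
      intro t x y
      induction t with
      | zero => simp
      | add p q hp hq => simp only [map_add, LinearMap.add_apply, hp, hq]
      | tmul p q =>
        rw [LinearMap.lTensor_tmul, ← (ℛ k q).eq, toHom_tmul, ← dual_comul_repr (ℛ k q)]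
        simp [TensorProduct.tmul_sum, Finset.sum_smul, smul_smul, mul_comm]
    have e13 : ∀ t : Hᵐᵒᵖ ⊗[k] HDual k H, (TensorProduct.assoc k _ _ _).symm (leg13 k _ _ t) =
      (Algebra.TensorProduct.includeLeft (R := k) (S := k) (A := Hᵐᵒᵖ) (B := HDual k H)).toLinearMap.rTensor
        (HDual k H) t := by
      intro t
      induction t with
      | zero => simp
      | add p q hp hq => simp only [map_add, hp, hq]
      | tmul p q => simp [leg13]
    have e12 : ∀ t : Hᵐᵒᵖ ⊗[k] HDual k H, (TensorProduct.assoc k _ _ _).symm (leg12 k _ _ t) =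
        t ⊗ₜ 1 := by
      intro t
      induction t with
      | zero => simp
      | add p q hp hq => simp only [map_add, hp, hq, TensorProduct.add_tmul]
      | tmul p q => simp [leg12]
    apply (TensorProduct.assoc k _ _ _).symm.injective
    refine toHom_ext fun y => toHom_ext fun x => ?_
    rw [key, toHom_opU]
    have e := map_mul (Algebra.TensorProduct.assoc k k k Hᵐᵒᵖ (HDual k H) (HDual k H)).symm
      (leg13 k Hᵐᵒᵖ (HDual k H) (opU k H)) (leg12 k Hᵐᵒᵖ (HDual k H) (opU k H))
    refine Eq.trans ?_ (congrArg (fun t => toHom k H Hᵐᵒᵖ (toHom k H _ t y) x) e.symm)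
    refine Eq.trans ?_ (congrArg (fun t => toHom k H Hᵐᵒᵖ (toHom k H _ t y) x)
      (congrArg₂ (· * ·) (e13 _) (e12 _)).symm)
    rw [toHom_mul _ _ (ℛ k y)]
    simp only [toHom_rTensor, toHom_opU, toHom_tmul, ev_one, mul_smul_comm, ← smul_mul_assoc,
      ← Finset.sum_mul, ← map_smul, ← map_sum]
    rw [show ∑ x ∈ (ℛ k y).index, counit (R := k) ((ℛ k y).right x) • MulOpposite.op ((ℛ k y).left x)
      = MulOpposite.op y from ?_]
    · simp [toHom_tmul_one_mul]
    · have := sum_tmul_counit_eq (ℛ k y)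
      have := congrArg (TensorProduct.rid k H) this
      simp only [map_sum, TensorProduct.rid_tmul, one_smul] at this
      simpa only [map_sum, map_smul, MulOpposite.coe_opLinearEquiv] using
        congrArg (MulOpposite.opLinearEquiv k) this
  counit_left := by
    refine dual_ext fun h => ?_
    have key : ∀ t : Hᵐᵒᵖ ⊗[k] HDual k H, ev k H (TensorProduct.lid k _ ((counit (R := k) (A := Hᵐᵒᵖ)).rTensor _ t)) h
      = counit (R := k) (toHom k H Hᵐᵒᵖ t h) := by
      intro t
      induction t with
      | zero => simp
      | add p q hp hq => simp only [map_add, LinearMap.add_apply, hp, hq]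
      | tmul p q => simp [mul_comm]
    rw [key]
    simp [MulOpposite.counit_def]
  counit_right := by
    have key : ∀ t : Hᵐᵒᵖ ⊗[k] HDual k H, (TensorProduct.rid k _ ((counit (R := k) (A := HDual k H)).lTensor _ t))
      = toHom k H Hᵐᵒᵖ t 1 := by
      intro t
      induction t with
      | zero => simp
      | add p q hp hq => simp only [map_add, LinearMap.add_apply, hp, hq]
      | tmul p q => simp
    rw [key]
    simp
  antipode_left := by
    refine toHom_ext fun h => ?_
    rw [toHom_rTensor]
    simp
    rfl
  antipode_antipode := by
    refine toHom_ext fun h => ?_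
    have key : ∀ t : Hᵐᵒᵖ ⊗[k] HDual k H, toHom k H Hᵐᵒᵖ ((antipode k (A := HDual k H)).lTensor _ t) h
      = toHom k H Hᵐᵒᵖ t (antipode k h) := by
      intro t
      induction t with
      | zero => simp
      | add p q hp hq => simp only [map_add, LinearMap.add_apply, hp, hq]
      | tmul p q =>
        rw [LinearMap.lTensor_tmul, toHom_tmul, toHom_tmul]
        exact congrArg (· • p) (ev_dualAntipode q h)
    rw [key]
    simp

end

section Ad
variable {k : Type*} [Field k] {X Y : Type*} [Ring X] [Algebra k X] [Ring Y] [Algebra k Y]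

/-- The image of an invertible element under an algebra homomorphism. -/
def umap (f : X →ₐ[k] Y) : Xˣ →* Yˣ := Units.map (f : X →* Y)

@[simp] theorem umap_coe (f : X →ₐ[k] Y) (u : Xˣ) : (umap f u : Y) = f u := rfl

@[simp] theorem umap_inv_coe (f : X →ₐ[k] Y) (u : Xˣ) :
    (↑(umap f u)⁻¹ : Y) = f (↑u⁻¹ : X) := rfl

variable (k) in
/-- `Ad(u)(x) = u x u⁻¹`. -/
noncomputable def Ad (u : Xˣ) : X →ₐ[k] X where
  toFun x := u * x * (↑u⁻¹ : X)
  map_one' := by simp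
  map_mul' x y := by simp [mul_assoc]
  map_zero' := by simp
  map_add' x y := by simp [mul_add, add_mul]
  commutes' c := by rw [← Algebra.commutes, mul_assoc]; simp

@[simp] theorem Ad_apply (u : Xˣ) (x : X) : Ad k u x = u * x * (↑u⁻¹ : X) := rfl

end Ad

section Twist
variable {k : Type*} [Field k] {A T B : Type*} [Ring A] [Ring T] [Ring B] [HopfAlgebra k A]
  [HopfAlgebra k T] [HopfAlgebra k B] (iA : A →ₐc[k] B) (iT : T →ₐc[k] B)

/-- `a ⊗ t ↦ t ⊗ a`, inside `B ⊗ B`. -/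
noncomputable def legJ : A ⊗[k] T →ₐ[k] B ⊗[k] B :=
  (Algebra.TensorProduct.map (iT : T →ₐ[k] B) (iA : A →ₐ[k] B)).comp
    (Algebra.TensorProduct.comm k A T).toAlgHom

@[simp] theorem legJ_tmul (a : A) (t : T) : legJ iA iT (a ⊗ₜ t) = iT t ⊗ₜ iA a := by
  simp [legJ]

noncomputable def leg3 : A ⊗[k] (T ⊗[k] T) →ₐ[k] B ⊗[k] (B ⊗[k] B) :=
  (Algebra.TensorProduct.map (iT : T →ₐ[k] B)
    (Algebra.TensorProduct.map (iT : T →ₐ[k] B) (iA : A →ₐ[k] B))).comp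
    ((Algebra.TensorProduct.assoc k k k T T A).toAlgHom.comp
      (Algebra.TensorProduct.comm k A (T ⊗[k] T)).toAlgHom)

@[simp] theorem leg3_tmul (a : A) (t t' : T) : leg3 iA iT (a ⊗ₜ (t ⊗ₜ t')) =
    iT t ⊗ₜ (iT t' ⊗ₜ iA a) := by
  simp [leg3]

noncomputable def leg3' : (A ⊗[k] A) ⊗[k] T →ₐ[k] B ⊗[k] (B ⊗[k] B) :=
  (Algebra.TensorProduct.map (iT : T →ₐ[k] B)
    (Algebra.TensorProduct.map (iA : A →ₐ[k] B) (iA : A →ₐ[k] B))).comp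
    (Algebra.TensorProduct.comm k (A ⊗[k] A) T).toAlgHom

@[simp] theorem leg3'_tmul (a a' : A) (t : T) : leg3' iA iT ((a ⊗ₜ a') ⊗ₜ t) =
    iT t ⊗ₜ (iA a ⊗ₜ iA a') := by
  simp [leg3']

variable (R : (A ⊗[k] T)ˣ)

/-- The twisting element `J = R₂₁ ∈ B ⊗ B`. -/
noncomputable def twistUnit : (B ⊗[k] B)ˣ := umap (legJ iA iT) R

/-- The twisted comultiplication `Ad(J) ∘ Δ`. -/
noncomputable def twistComul : B →ₐ[k] B ⊗[k] B :=
  (Ad k (twistUnit iA iT R)).comp (Bialgebra.comulAlgHom k B)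

variable {R iA iT}

theorem comul_legJ_left (r : A ⊗[k] T) : TensorProduct.assoc k B B B
    ((comul (R := k) (A := B)).rTensor B (legJ iA iT r)) =
    leg3 iA iT ((comul (R := k) (A := T)).lTensor A r) := by
  induction r with
  | zero => simp
  | add p q hp hq => simp only [map_add, hp, hq]
  | tmul a t =>
    have := CoalgHomClass.map_comp_comul_apply iT t
    rw [legJ_tmul, LinearMap.rTensor_tmul, LinearMap.lTensor_tmul, ← this, ← (ℛ k t).eq]
    simp [TensorProduct.tmul_sum, TensorProduct.sum_tmul]

theorem comul_legJ_right (r : A ⊗[k] T) :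
    (comul (R := k) (A := B)).lTensor B (legJ iA iT r) =
    leg3' iA iT ((comul (R := k) (A := A)).rTensor T r) := by
  induction r with
  | zero => simp
  | add p q hp hq => simp only [map_add, hp, hq]
  | tmul a t =>
    have := CoalgHomClass.map_comp_comul_apply iA a
    rw [legJ_tmul, LinearMap.rTensor_tmul, LinearMap.lTensor_tmul, ← this, ← (ℛ k a).eq]
    simp [TensorProduct.tmul_sum, TensorProduct.sum_tmul]

theorem leg3_leg13 (r : A ⊗[k] T) : leg3 iA iT (leg13 k A T r) = 1 ⊗ₜ legJ iA iT r := by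
  induction r with
  | zero => simp
  | add p q hp hq => simp only [map_add, hp, hq, TensorProduct.tmul_add]
  | tmul a t => simp [leg13]

theorem leg3'_leg13' (r : A ⊗[k] T) : leg3' iA iT (leg13' k A T r) =
    TensorProduct.assoc k B B B (legJ iA iT r ⊗ₜ 1) := by
  induction r with
  | zero => simp
  | add p q hp hq => simp only [map_add, hp, hq, TensorProduct.add_tmul]
  | tmul a t => simp [leg13']

theorem leg3_leg12 (r : A ⊗[k] T) : leg3 iA iT (leg12 k A T r) = leg3' iA iT (leg23' k A T r) := by
  induction r with
  | zero => simp
  | add p q hp hq => simp only [map_add, hp, hq]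
  | tmul a t => simp [leg12, leg23']

theorem legJ_commute (hc : ∀ a t, iA a * iT t = iT t * iA a) (r s : A ⊗[k] T) : (1 ⊗ₜ legJ iA iT r) *
      TensorProduct.assoc k B B B (legJ iA iT s ⊗ₜ 1) =
    TensorProduct.assoc k B B B (legJ iA iT s ⊗ₜ 1) * (1 ⊗ₜ legJ iA iT r) := by
  induction r with
  | zero => simp
  | add p q hp hq => simp only [map_add, TensorProduct.tmul_add, add_mul, mul_add, hp, hq]
  | tmul a t =>
    induction s with
    | zero => simp
    | add p q hp hq => simp only [map_add, TensorProduct.add_tmul, add_mul, mul_add, hp, hq]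
    | tmul b u => simp [hc]

theorem twist_cocycle (hc : ∀ a t, iA a * iT t = iT t * iA a) (hR : IsBicharacter R) :
    TensorProduct.assoc k B B B ((twistUnit iA iT R : B ⊗[k] B) ⊗ₜ 1) *
      TensorProduct.assoc k B B B ((comul (R := k) (A := B)).rTensor B (twistUnit iA iT R : B ⊗[k] B)) =
    (1 ⊗ₜ (twistUnit iA iT R : B ⊗[k] B)) *
      (comul (R := k) (A := B)).lTensor B (twistUnit iA iT R : B ⊗[k] B) := by
  simp only [twistUnit, umap_coe]
  rw [comul_legJ_left, comul_legJ_right, hR.comul_left, hR.comul_right, map_mul, map_mul,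
    leg3_leg13, leg3'_leg13', leg3_leg12, ← mul_assoc, ← mul_assoc, legJ_commute hc]

theorem twist_coassoc (hc : ∀ a t, iA a * iT t = iT t * iA a) (hR : IsBicharacter R) :
    TensorProduct.assoc k B B B ∘ₗ (twistComul iA iT R).toLinearMap.rTensor B ∘ₗ
      (twistComul iA iT R).toLinearMap =
    (twistComul iA iT R).toLinearMap.lTensor B ∘ₗ (twistComul iA iT R).toLinearMap := by
  let as := Algebra.TensorProduct.assoc k k k B B B
  let Dl : B ⊗[k] B →ₐ[k] B ⊗[k] (B ⊗[k] B) := as.toAlgHom.comp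
    (Algebra.TensorProduct.map (Bialgebra.comulAlgHom k B) (AlgHom.id k B))
  let Dr : B ⊗[k] B →ₐ[k] B ⊗[k] (B ⊗[k] B) :=
    (Algebra.TensorProduct.map (AlgHom.id k B) (Bialgebra.comulAlgHom k B))
  let il : B ⊗[k] B →ₐ[k] B ⊗[k] (B ⊗[k] B) := as.toAlgHom.comp
    Algebra.TensorProduct.includeLeft
  let ir : B ⊗[k] B →ₐ[k] B ⊗[k] (B ⊗[k] B) := Algebra.TensorProduct.includeRight
  let J := twistUnit iA iT R
  have hW : umap il J * umap Dl J = umap ir J * umap Dr J := by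
    ext
    exact twist_cocycle hc hR
  have hl : ∀ z : B ⊗[k] B, TensorProduct.assoc k B B B
      ((twistComul iA iT R).toLinearMap.rTensor B z) = Ad k (umap il J) (Dl z) := by
    intro z
    induction z with
    | zero => simp
    | add p q hp hq => simp only [map_add, hp, hq]
    | tmul a t =>
      have h1 : (twistComul iA iT R a) ⊗ₜ[k] t = ((J : B ⊗[k] B) ⊗ₜ[k] (1 : B)) *
        (comul (R := k) a ⊗ₜ t) * ((↑J⁻¹ : B ⊗[k] B) ⊗ₜ[k] (1 : B)) := by
        simp [twistComul, J]
      rw [LinearMap.rTensor_tmul]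
      refine (congrArg as h1).trans ?_
      rw [map_mul, map_mul]
      rfl
  have hr : ∀ z : B ⊗[k] B, (twistComul iA iT R).toLinearMap.lTensor B z =
      Ad k (umap ir J) (Dr z) := by
    intro z
    induction z with
    | zero => simp
    | add p q hp hq => simp only [map_add, hp, hq]
    | tmul a t =>
      have h1 : a ⊗ₜ[k] (twistComul iA iT R t) = ((1 : B) ⊗ₜ[k] (J : B ⊗[k] B)) *
        (a ⊗ₜ comul (R := k) t) * ((1 : B) ⊗ₜ[k] (↑J⁻¹ : B ⊗[k] B)) := by
        simp [twistComul, J]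
      rw [LinearMap.lTensor_tmul]
      exact h1
  have hAd : ∀ (f g : B ⊗[k] B →ₐ[k] B ⊗[k] (B ⊗[k] B)) (x : B),
      Ad k (umap f J) (g (twistComul iA iT R x)) =
        Ad k (umap f J * umap g J) (g (comul (R := k) x)) := by
    intro f g x
    have hf : ∀ z, f (↑J⁻¹ : B ⊗[k] B) * (f (J : B ⊗[k] B) * z) = z := by
      intro z
      rw [← mul_assoc, ← map_mul, J.inv_mul, map_one, one_mul]
    simp only [twistComul, AlgHom.comp_apply, Ad_apply, map_mul, Units.val_mul, umap_coe,
      umap_inv_coe, mul_inv_rev, mul_assoc, Bialgebra.comulAlgHom_apply, hf]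
    rfl
  ext x : 1
  simp only [LinearMap.comp_apply, LinearEquiv.coe_coe]
  have el : Dl (comul (R := k) x) = Dr (comul (R := k) x) := coassoc_apply x
  rw [hl, hr]
  refine (hAd il Dl x).trans (Eq.trans ?_ (hAd ir Dr x).symm)
  rw [hW, el]

theorem twist_counit_left (hR : IsBicharacter R) :
    (counit (R := k) (A := B)).rTensor B ∘ₗ (twistComul iA iT R).toLinearMap =
      TensorProduct.mk k k B 1 := by
  let e : B ⊗[k] B →ₐ[k] k ⊗[k] B :=
    Algebra.TensorProduct.map (Bialgebra.counitAlgHom k B) (AlgHom.id k B)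
  have h : ∀ r : A ⊗[k] T, e (legJ iA iT r) = 1 ⊗ₜ (iA (TensorProduct.rid k A
    ((counit (R := k) (A := T)).lTensor A r))) := by
    intro r
    induction r with
    | zero => simp
    | add p q hp hq => simp only [map_add, hp, hq, TensorProduct.tmul_add]
    | tmul a t => simp [e, TensorProduct.tmul_smul, TensorProduct.smul_tmul']
  have hJ : umap e (twistUnit iA iT R) = 1 := by
    ext
    simp only [twistUnit, umap_coe]
    rw [h, hR.counit_right, map_one]
    rfl
  ext x : 1
  have e1 : e (twistComul iA iT R x) = Ad k (umap e (twistUnit iA iT R)) (e (comul (R := k) x)) := by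
    simp [twistComul]
  refine e1.trans ?_
  rw [hJ]
  simp only [Ad_apply, Units.val_one, inv_one, one_mul, mul_one]
  exact rTensor_counit_comul x

theorem twist_counit_right (hR : IsBicharacter R) :
    (counit (R := k) (A := B)).lTensor B ∘ₗ (twistComul iA iT R).toLinearMap =
      (TensorProduct.mk k B k).flip 1 := by
  let e : B ⊗[k] B →ₐ[k] B ⊗[k] k :=
    Algebra.TensorProduct.map (AlgHom.id k B) (Bialgebra.counitAlgHom k B)
  have h : ∀ r : A ⊗[k] T, e (legJ iA iT r) = (iT (TensorProduct.lid k T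
    ((counit (R := k) (A := A)).rTensor T r))) ⊗ₜ 1 := by
    intro r
    induction r with
    | zero => simp
    | add p q hp hq => simp only [map_add, hp, hq, TensorProduct.add_tmul]
    | tmul a t => simp [e, TensorProduct.smul_tmul]
  have hJ : umap e (twistUnit iA iT R) = 1 := by
    ext
    simp only [twistUnit, umap_coe]
    rw [h, hR.counit_left, map_one]
    rfl
  ext x : 1
  have e1 : e (twistComul iA iT R x) = Ad k (umap e (twistUnit iA iT R)) (e (comul (R := k) x)) := by
    simp [twistComul]
  refine e1.trans ?_
  rw [hJ]
  simp only [Ad_apply, Units.val_one, inv_one, one_mul, mul_one]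
  exact lTensor_counit_comul x


variable (iA iT) in
/-- `a ⊗ t ↦ a t` -/
noncomputable def joint : A ⊗[k] T →ₗ[k] B :=
  LinearMap.mul' k B ∘ₗ TensorProduct.map (iA : A →ₗ[k] B) (iT : T →ₗ[k] B)

@[simp] theorem joint_tmul (a : A) (t : T) : joint iA iT (a ⊗ₜ t) = iA a * iT t := by
  simp [joint]

theorem joint_mul (hc : ∀ a t, iA a * iT t = iT t * iA a) (r s : A ⊗[k] T) :
    joint iA iT (r * s) = joint iA iT r * joint iA iT s := by
  induction r with
  | zero => simp
  | add p q hp hq => simp only [map_add, add_mul, hp, hq]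
  | tmul a t =>
    induction s with
    | zero => simp
    | add p q hp hq => simp only [map_add, mul_add, hp, hq]
    | tmul b u =>
      simp only [Algebra.TensorProduct.tmul_mul_tmul, joint_tmul, map_mul]
      rw [mul_assoc, ← mul_assoc (iA b), hc b t, mul_assoc, mul_assoc]

theorem joint_one : joint iA iT 1 = 1 := by
  simp [Algebra.TensorProduct.one_def]

theorem bialgHom_antipode {A B : Type*} [Ring A] [Ring B] [HopfAlgebra k A] [HopfAlgebra k B]
    (f : A →ₐc[k] B) (a : A) : antipode k (f a) = f (antipode k a) := by
  have h1 : toConv (antipode k ∘ₗ (f : A →ₗ[k] B)) * toConv (f : A →ₗ[k] B) = 1 := by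
    have := convMul_comp_coalgHom_distrib (toConv (antipode k (A := B))) (toConv LinearMap.id)
      (f : A →ₗc[k] B)
    rw [antipode_mul_id] at this
    refine Eq.trans (congrArg toConv this.symm) ?_
    ext x
    simp
  have h2 : toConv (f : A →ₗ[k] B) * toConv ((f : A →ₗ[k] B) ∘ₗ antipode k) = 1 := by
    have := algHom_comp_convMul_distrib (f : A →ₐ[k] B) (toConv (LinearMap.id : A →ₗ[k] A))
      (toConv (antipode k (A := A)))
    rw [id_mul_antipode] at this
    refine Eq.trans (congrArg toConv this.symm) ?_
    ext x
    simp
    exact AlgHomClass.commutes f _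
  exact congrArg (fun g => g a) (left_inv_eq_right_inv h1 h2)

theorem mul_comm_aux {B : Type*} [Ring B] {p q x y : B} (px : p * x = x * p) (qx : q * x = x * q)
    (qy : q * y = y * q) : x * (p * y) * q = p * q * (x * y) :=
  calc x * (p * y) * q = (x * p) * (y * q) := by simp only [mul_assoc]
    _ = (p * x) * (q * y) := by rw [px, qy]
    _ = p * (x * q) * y := by simp only [mul_assoc]
    _ = p * (q * x) * y := by rw [qx]
    _ = _ := by simp only [mul_assoc]

variable (iA iT) in
/-- `a ⊗ t ↦ S(t) y a` -/
noncomputable def sandL (y : B) : A ⊗[k] T →ₗ[k] B :=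
  TensorProduct.lift (LinearMap.mk₂ k (fun a t => iT (antipode k t) * y * iA a)
    (by intros; simp [mul_add]) (by intros; simp) (by intros; simp [add_mul]) (by intros; simp))

variable (iA iT) in
/-- `a ⊗ t ↦ t y S(a)` -/
noncomputable def sandR (y : B) : A ⊗[k] T →ₗ[k] B :=
  TensorProduct.lift (LinearMap.mk₂ k (fun a t => iT t * y * iA (antipode k a))
    (by intros; simp [mul_add]) (by intros; simp) (by intros; simp [add_mul]) (by intros; simp))

@[simp] theorem sandL_tmul (y : B) (a : A) (t : T) :
    sandL iA iT y (a ⊗ₜ t) = iT (antipode k t) * y * iA a := by simp [sandL]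

@[simp] theorem sandR_tmul (y : B) (a : A) (t : T) :
    sandR iA iT y (a ⊗ₜ t) = iT t * y * iA (antipode k a) := by simp [sandR]

theorem sandL_add (y z : B) (r : A ⊗[k] T) :
    sandL iA iT (y + z) r = sandL iA iT y r + sandL iA iT z r := by
  induction r with
  | zero => simp
  | add p q hp hq => simp only [map_add, hp, hq]; abel
  | tmul a t => simp [mul_add, add_mul]

theorem sandR_add (y z : B) (r : A ⊗[k] T) :
    sandR iA iT (y + z) r = sandR iA iT y r + sandR iA iT z r := by
  induction r with
  | zero => simp
  | add p q hp hq => simp only [map_add, hp, hq]; abel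
  | tmul a t => simp [mul_add, add_mul]

theorem sandL_zero (r : A ⊗[k] T) : sandL iA iT (0 : B) r = 0 := by
  have := sandL_add (iA := iA) (iT := iT) 0 0 r
  simpa using this

theorem sandR_zero (r : A ⊗[k] T) : sandR iA iT (0 : B) r = 0 := by
  have := sandR_add (iA := iA) (iT := iT) 0 0 r
  simpa using this

theorem sandL_joint (hc : ∀ a t, iA a * iT t = iT t * iA a) (r s : A ⊗[k] T) :
    sandL iA iT (joint iA iT ((antipode k (A := T)).lTensor A s)) r =
      joint iA iT ((antipode k (A := T)).lTensor A (s * r)) := by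
  induction s with
  | zero => simp [sandL_zero]
  | add p q hp hq => simp only [map_add, add_mul, sandL_add, hp, hq]
  | tmul a t =>
    induction r with
    | zero => simp
    | add p q hp hq => simp only [map_add, mul_add, hp, hq]
    | tmul b u =>
      simp only [LinearMap.lTensor_tmul, sandL_tmul, joint_tmul, Algebra.TensorProduct.tmul_mul_tmul,
        HopfAlgebra.antipode_mul_antidistrib, map_mul]
      exact mul_comm_aux (hc _ _) (hc _ _) (hc _ _)

theorem sandR_joint (hc : ∀ a t, iA a * iT t = iT t * iA a) (r s : A ⊗[k] T) :
    sandR iA iT (joint iA iT ((antipode k (A := A)).rTensor T s)) r =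
      joint iA iT ((antipode k (A := A)).rTensor T (r * s)) := by
  induction s with
  | zero => simp [sandR_zero]
  | add p q hp hq => simp only [map_add, mul_add, sandR_add, hp, hq]
  | tmul a t =>
    induction r with
    | zero => simp
    | add p q hp hq => simp only [map_add, add_mul, hp, hq]
    | tmul b u =>
      simp only [LinearMap.rTensor_tmul, sandR_tmul, joint_tmul, Algebra.TensorProduct.tmul_mul_tmul,
        HopfAlgebra.antipode_mul_antidistrib, map_mul]
      exact mul_comm_aux (hc _ _) (hc _ _) (hc _ _)

variable (iA iT R) in
/-- The antipode of the twisted Hopf algebra. -/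
noncomputable def twistAntipode : B →ₗ[k] B :=
  LinearMap.mulRight k (joint iA iT R) ∘ₗ
    LinearMap.mulLeft k (joint iA iT (↑R⁻¹ : A ⊗[k] T)) ∘ₗ antipode k

theorem twistAntipode_apply (x : B) : twistAntipode iA iT R x =
    joint iA iT (↑R⁻¹ : A ⊗[k] T) * antipode k x * joint iA iT R := rfl

/-- `x ⊗ y ↦ S(x) c y` -/
noncomputable def midL (c : B) : B ⊗[k] B →ₗ[k] B :=
  LinearMap.mul' k B ∘ₗ TensorProduct.map (LinearMap.mulRight k c ∘ₗ antipode k) LinearMap.id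

/-- `x ⊗ y ↦ x c S(y)` -/
noncomputable def midR (c : B) : B ⊗[k] B →ₗ[k] B :=
  LinearMap.mul' k B ∘ₗ TensorProduct.map (LinearMap.mulRight k c) (antipode k)

theorem midL_mul (r r' : A ⊗[k] T) (z : B ⊗[k] B) (c : B) :
    midL c (legJ iA iT r * z * legJ iA iT r') =
      sandL iA iT (midL (sandL iA iT c r) z) r' := by
  induction z with
  | zero => simp [sandL_zero]
  | add p q hp hq => simp only [map_add, add_mul, mul_add, sandL_add, hp, hq]
  | tmul x y =>
    induction r' with
    | zero => simp
    | add p q hp hq => simp only [map_add, mul_add, hp, hq]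
    | tmul b u =>
      induction r with
      | zero => simp [midL]
      | add p q hp hq =>
        simp only [midL, map_add, add_mul, LinearMap.comp_apply, TensorProduct.map_tmul,
          LinearMap.mulRight_apply, LinearMap.mul'_apply, sandL_tmul, mul_add, LinearMap.id_apply] at hp hq ⊢
        rw [hp, hq]
      | tmul a t =>
        simp [midL, HopfAlgebra.antipode_mul_antidistrib, bialgHom_antipode, mul_assoc]

theorem midR_mul (r r' : A ⊗[k] T) (z : B ⊗[k] B) (c : B) :
    midR c (legJ iA iT r * z * legJ iA iT r') =
      sandR iA iT (midR (sandR iA iT c r') z) r := by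
  induction z with
  | zero => simp [sandR_zero]
  | add p q hp hq => simp only [map_add, add_mul, mul_add, sandR_add, hp, hq]
  | tmul x y =>
    induction r with
    | zero => simp
    | add p q hp hq => simp only [map_add, add_mul, hp, hq]
    | tmul b u =>
      induction r' with
      | zero => simp [midR]
      | add p q hp hq =>
        simp only [midR, map_add, add_mul, LinearMap.comp_apply, TensorProduct.map_tmul,
          LinearMap.mulRight_apply, LinearMap.mul'_apply, sandR_tmul, mul_add] at hp hq ⊢
        rw [hp, hq]
      | tmul a t =>
        simp [midR, HopfAlgebra.antipode_mul_antidistrib, bialgHom_antipode, mul_assoc]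

theorem twist_antipode_left (hc : ∀ a t, iA a * iT t = iT t * iA a) (hR : IsBicharacter R) :
    LinearMap.mul' k B ∘ₗ (twistAntipode iA iT R).rTensor B ∘ₗ (twistComul iA iT R).toLinearMap =
      Algebra.linearMap k B ∘ₗ counit := by
  have h1 : ∀ z : B ⊗[k] B, LinearMap.mul' k B ((twistAntipode iA iT R).rTensor B z) =
      joint iA iT (↑R⁻¹ : A ⊗[k] T) * midL (joint iA iT R) z := by
    intro z
    induction z with
    | zero => simp
    | add p q hp hq => simp only [map_add, mul_add, hp, hq]
    | tmul x y => simp [midL, twistAntipode_apply, mul_assoc]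
  have hS : joint iA iT ((antipode k (A := T)).lTensor A (1 : A ⊗[k] T)) = 1 := by
    rw [Algebra.TensorProduct.one_def]
    simp
  have h2 : sandL iA iT (joint iA iT R) R = 1 := by
    have h := sandL_joint hc (R : A ⊗[k] T) (↑R⁻¹ : A ⊗[k] T)
    rwa [hR.antipode_antipode, Units.inv_mul, hS] at h
  have h3 : sandL iA iT 1 (↑R⁻¹ : A ⊗[k] T) = joint iA iT R := by
    conv_lhs => rw [← hS]
    rw [sandL_joint hc, one_mul, hR.antipode_antipode]
  ext x : 1
  simp only [LinearMap.comp_apply, h1]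
  have h4 : midL (joint iA iT R) (twistComul iA iT R x) =
      sandL iA iT (midL 1 (comul (R := k) x)) (↑R⁻¹ : A ⊗[k] T) := by
    rw [← h2]
    exact midL_mul _ _ _ _
  have h5 : midL 1 (comul (R := k) x) = algebraMap k B (counit x) := by
    have := mul_antipode_rTensor_comul_apply (R := k) x
    rw [← this]
    simp [midL, LinearMap.rTensor]
  refine (congrArg (joint iA iT (↑R⁻¹ : A ⊗[k] T) * ·) h4).trans ?_
  have h6 : ∀ c : k, sandL iA iT (algebraMap k B c) (↑R⁻¹ : A ⊗[k] T) = c • joint iA iT R := by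
    intro c
    rw [← h3]
    induction (↑R⁻¹ : A ⊗[k] T) with
    | zero => simp
    | add p q hp hq => simp only [map_add, smul_add, hp, hq]
    | tmul a t => simp [Algebra.algebraMap_eq_smul_one]
  rw [h5]
  simp only [h6]
  rw [mul_smul_comm, ← joint_mul hc, Units.inv_mul, joint_one]
  simp [Algebra.algebraMap_eq_smul_one]

theorem twist_antipode_right (hc : ∀ a t, iA a * iT t = iT t * iA a) (hR : IsBicharacter R) :
    LinearMap.mul' k B ∘ₗ (twistAntipode iA iT R).lTensor B ∘ₗ (twistComul iA iT R).toLinearMap =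
      Algebra.linearMap k B ∘ₗ counit := by
  have h1 : ∀ z : B ⊗[k] B, LinearMap.mul' k B ((twistAntipode iA iT R).lTensor B z) =
      midR (joint iA iT (↑R⁻¹ : A ⊗[k] T)) z * joint iA iT R := by
    intro z
    induction z with
    | zero => simp
    | add p q hp hq => simp only [map_add, add_mul, hp, hq]
    | tmul x y => simp [midR, twistAntipode_apply, mul_assoc]
  have hS : joint iA iT ((antipode k (A := A)).rTensor T (1 : A ⊗[k] T)) = 1 := by
    rw [Algebra.TensorProduct.one_def]
    simp
  have h2 : sandR iA iT (joint iA iT (↑R⁻¹ : A ⊗[k] T)) (↑R⁻¹ : A ⊗[k] T) = 1 := by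
    have h := sandR_joint hc (↑R⁻¹ : A ⊗[k] T) (R : A ⊗[k] T)
    rwa [hR.antipode_left, Units.inv_mul, hS] at h
  have h3 : sandR iA iT 1 (R : A ⊗[k] T) = joint iA iT (↑R⁻¹ : A ⊗[k] T) := by
    conv_lhs => rw [← hS]
    rw [sandR_joint hc, mul_one, hR.antipode_left]
  ext x : 1
  simp only [LinearMap.comp_apply, h1]
  have h4 : midR (joint iA iT (↑R⁻¹ : A ⊗[k] T)) (twistComul iA iT R x) =
      sandR iA iT (midR 1 (comul (R := k) x)) (R : A ⊗[k] T) := by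
    rw [← h2]
    exact midR_mul _ _ _ _
  have h5 : midR 1 (comul (R := k) x) = algebraMap k B (counit x) := by
    have := mul_antipode_lTensor_comul_apply (R := k) x
    rw [← this]
    simp [midR, LinearMap.lTensor]
  refine (congrArg (· * joint iA iT (R : A ⊗[k] T)) h4).trans ?_
  have h6 : ∀ c : k, sandR iA iT (algebraMap k B c) (R : A ⊗[k] T) =
      c • joint iA iT (↑R⁻¹ : A ⊗[k] T) := by
    intro c
    rw [← h3]
    induction (R : A ⊗[k] T) with
    | zero => simp
    | add p q hp hq => simp only [map_add, smul_add, hp, hq]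
    | tmul a t => simp [Algebra.algebraMap_eq_smul_one]
  rw [h5]
  simp only [h6]
  rw [smul_mul_assoc, ← joint_mul hc, Units.inv_mul, joint_one]
  simp [Algebra.algebraMap_eq_smul_one]

/-- The Hopf algebra structure with comultiplication `Ad(J) ∘ Δ`. -/
@[reducible] noncomputable def twistHopfAlgebra (hc : ∀ a t, iA a * iT t = iT t * iA a)
    (hR : IsBicharacter R) : HopfAlgebra k B where
  comul := (twistComul iA iT R).toLinearMap
  counit := counit (R := k) (A := B)
  coassoc := twist_coassoc hc hR
  rTensor_counit_comp_comul := twist_counit_left hR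
  lTensor_counit_comp_comul := twist_counit_right hR
  counit_one := Bialgebra.counit_one
  mul_compr₂_counit := Bialgebra.mul_compr₂_counit
  comul_one := map_one (twistComul iA iT R)
  mul_compr₂_comul := by
    ext x y
    exact map_mul (twistComul iA iT R) x y
  antipode := twistAntipode iA iT R
  mul_antipode_rTensor_comul := twist_antipode_left hc hR
  mul_antipode_lTensor_comul := twist_antipode_right hc hR

end Twist

section
variable {k : Type*} [Field k] {A T B : Type*} [Ring A] [Ring T] [Ring B] [HopfAlgebra k A]
  [HopfAlgebra k T] [HopfAlgebra k B] {iA : A →ₐc[k] B} {iT : T →ₐc[k] B} {R : (A ⊗[k] T)ˣ}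

theorem legJ_commute_outer (hc : ∀ a t, iA a * iT t = iT t * iA a) (a : A) (t : T)
    (x : A ⊗[k] T) : legJ iA iT x * (iA a ⊗ₜ iT t) = (iA a ⊗ₜ iT t) * legJ iA iT x := by
  induction x with
  | zero => simp
  | add p q hp hq => simp only [map_add, mul_add, add_mul, hp, hq]
  | tmul b u => simp [hc]

theorem twistComul_mul (hc : ∀ a t, iA a * iT t = iT t * iA a) {ι κ : Type*} {a : A} {t : T}
    (r : Repr k a ι) (s : Repr k t κ) :
    twistComul iA iT R (iA a * iT t) = ∑ i ∈ r.index, ∑ j ∈ s.index,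
      (iA (r.left i) ⊗ₜ iT (s.right j)) * legJ iA iT (Ad k R (r.right i ⊗ₜ s.left j)) := by
  have h1 : comul (R := k) (iA a * iT t) = ∑ i ∈ r.index, ∑ j ∈ s.index,
      (iA (r.left i) ⊗ₜ iT (s.right j)) * legJ iA iT (r.right i ⊗ₜ s.left j) := by
    rw [Bialgebra.comul_mul, ← CoalgHomClass.map_comp_comul_apply iA a,
      ← CoalgHomClass.map_comp_comul_apply iT t, ← r.eq, ← s.eq]
    simp [Finset.sum_mul_sum, hc]
  simp only [twistComul, AlgHom.comp_apply, Bialgebra.comulAlgHom_apply, h1, map_sum]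
  refine Finset.sum_congr rfl fun i _ => Finset.sum_congr rfl fun j _ => ?_
  rw [Ad_apply, Ad_apply]
  simp only [twistUnit, umap_coe, umap_inv_coe, map_mul]
  rw [← mul_assoc, legJ_commute_outer hc]
  simp only [mul_assoc]
end

section Codouble
variable (k : Type*) [Field k] (H : Type*) [Ring H] [HopfAlgebra k H]

/-- The underlying algebra `Hᵒᵖ ⊗ Ĥ` of the Drinfeld codouble. -/
def Codouble : Type _ := Hᵐᵒᵖ ⊗[k] HDual k H

noncomputable instance : Ring (Codouble k H) := inferInstanceAs (Ring (Hᵐᵒᵖ ⊗[k] HDual k H))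

variable [Module.Finite k H]

noncomputable def inclOp : Hᵐᵒᵖ →ₐc[k] Hᵐᵒᵖ ⊗[k] HDual k H :=
  BialgHom.ofAlgHom Algebra.TensorProduct.includeLeft
    (by ext; simp)
    (by
      ext a
      simp [TensorProduct.comul_tmul, ← (ℛ k a).eq, TensorProduct.sum_tmul,
        Algebra.TensorProduct.one_def])

noncomputable def inclDual : HDual k H →ₐc[k] Hᵐᵒᵖ ⊗[k] HDual k H :=
  BialgHom.ofAlgHom Algebra.TensorProduct.includeRight
    (by ext; simp)
    (by
      ext a
      simp [TensorProduct.comul_tmul, ← (ℛ k a).eq, TensorProduct.tmul_sum,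
        Algebra.TensorProduct.one_def])

theorem incl_commute (a : Hᵐᵒᵖ) (t : HDual k H) :
    inclOp k H a * inclDual k H t = inclDual k H t * inclOp k H a := by
  simp [inclOp, inclDual]

/-- The Drinfeld codouble: its comultiplication is
`Δ(c ⊗ θ) = (id ⊗ Σ ∘ Ad(°U) ⊗ id)(c₁ ⊗ (c₂ ⊗ θ₁) ⊗ θ₂)`, see `codouble_comul_tmul`. -/
noncomputable instance instHopfAlgebraCodouble : HopfAlgebra k (Codouble k H) :=
  twistHopfAlgebra (B := Hᵐᵒᵖ ⊗[k] HDual k H) (incl_commute k H) opU_isBicharacter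

/-- The identification of the Drinfeld codouble with `Hᵒᵖ ⊗ Ĥ` as an algebra. -/
noncomputable def codoubleEquiv : Hᵐᵒᵖ ⊗[k] HDual k H ≃ₐ[k] Codouble k H where
  __ := RingEquiv.refl _
  commutes' _ := rfl

instance : Module.Finite k (Codouble k H) :=
  Module.Finite.equiv (codoubleEquiv k H).toLinearEquiv


variable {k H} in
/-- The comultiplication of the Drinfeld codouble, written out on `c ⊗ θ`. -/
theorem codouble_comul_tmul {ι κ : Type*} {c : Hᵐᵒᵖ} {θ : HDual k H} (r : Repr k c ι)
    (s : Repr k θ κ) :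
    comul (R := k) (codoubleEquiv k H (c ⊗ₜ θ)) =
      Algebra.TensorProduct.map (codoubleEquiv k H).toAlgHom (codoubleEquiv k H).toAlgHom
        (∑ i ∈ r.index, ∑ j ∈ s.index, (inclOp k H (r.left i) ⊗ₜ inclDual k H (s.right j)) *
          legJ (inclOp k H) (inclDual k H) (Ad k (opU k H) (r.right i ⊗ₜ s.left j))) := by
  rw [← twistComul_mul (incl_commute k H)]
  have hid : ∀ z, Algebra.TensorProduct.map (codoubleEquiv k H).toAlgHom
      (codoubleEquiv k H).toAlgHom z = z := by
    intro z
    induction z with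
    | zero => exact map_zero _
    | add p q hp hq => exact (map_add _ p q).trans (congrArg₂ (· + ·) hp hq)
    | tmul x y => rfl
  rw [hid, show inclOp k H c * inclDual k H θ = c ⊗ₜ θ by simp [inclOp, inclDual]]
  rfl

/-- The Drinfeld double, the dual Hopf algebra of the Drinfeld codouble. -/
abbrev DrinfeldDouble : Type _ := HDual k (Codouble k H)

/-- `H ≃ (Ĥ)^*`, `a ↦ (θ ↦ θ(a))`. -/
noncomputable def evalDual : H ≃ₗ[k] (HDual k H →ₗ[k] k) :=
  (Module.evalEquiv k H).trans (ev k H).dualMap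

/-- The linear identification `Ĥ ⊗ H ≃ 𝓓(H)`, `ω ⊗ a ↦ ω ⋈ a`, where `ω ⋈ a` is the functional
`cᵒᵖ ⊗ θ ↦ ω(c) θ(a)` on the codouble. -/
noncomputable def doubleEquiv : HDual k H ⊗[k] H ≃ₗ[k] DrinfeldDouble k H :=
  (TensorProduct.congr ((ev k H).trans (MulOpposite.opLinearEquiv k).symm.dualMap)
    (evalDual k H)).trans ((TensorProduct.dualDistribEquiv k Hᵐᵒᵖ (HDual k H)).trans
      ((codoubleEquiv k H).symm.toLinearEquiv.dualMap.trans (ev k (Codouble k H)).symm))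

theorem ev_doubleEquiv (ω : HDual k H) (a c : H) (θ : HDual k H) :
    ev k (Codouble k H) (doubleEquiv k H (ω ⊗ₜ a)) (codoubleEquiv k H (MulOpposite.op c ⊗ₜ θ)) =
      ev k H ω c * ev k H θ a := by
  simp [doubleEquiv, evalDual]

/-- The canonical element of the pairing `p_𝓓(d, t) = d(t)` of the double with the codouble. -/
noncomputable def canW : (DrinfeldDouble k H ⊗[k] Codouble k H)ˣ :=
  umap (Algebra.TensorProduct.comm k (Codouble k H) (DrinfeldDouble k H)).toAlgHom
    (canU k (Codouble k H))

theorem double_comul_tmul {ι κ : Type*} {ω : HDual k H} {a : H} (r : Repr k ω ι) (s : Repr k a κ) :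
    comul (R := k) (doubleEquiv k H (ω ⊗ₜ a)) = ∑ i ∈ r.index, ∑ j ∈ s.index,
      doubleEquiv k H (r.right i ⊗ₜ s.left j) ⊗ₜ doubleEquiv k H (r.left i ⊗ₜ s.right j) := by
  refine ev₂_ext fun x y => ?_
  rw [ev₂_comul]
  simp only [map_sum, LinearMap.sum_apply, ev₂_tmul, LinearMap.mul'_apply]
  obtain ⟨x, rfl⟩ := (codoubleEquiv k H).surjective x
  obtain ⟨y, rfl⟩ := (codoubleEquiv k H).surjective y
  rw [← map_mul]
  induction x with
  | zero => simp
  | add p q hp hq => simp only [map_add, add_mul, hp, hq, Finset.sum_add_distrib]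
  | tmul c θ =>
    induction y with
    | zero => simp
    | add p q hp hq => simp only [map_add, mul_add, hp, hq, Finset.sum_add_distrib]
    | tmul c' θ' =>
      induction c using MulOpposite.rec' with | _ c => ?_
      induction c' using MulOpposite.rec' with | _ c' => ?_
      rw [Algebra.TensorProduct.tmul_mul_tmul, ← MulOpposite.op_mul, ev_doubleEquiv,
        ← dual_comul_repr r, ev_mul_repr s, Finset.sum_mul_sum]
      simp only [ev_doubleEquiv]
      exact Finset.sum_congr rfl fun i _ => Finset.sum_congr rfl fun j _ => by ring

end Codouble

section Smash
variable {k : Type*} [Field k] {A B : Type*} [Ring A] [Algebra k A] [Ring B] [Bialgebra k B]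
  (act : B →ₐ[k] Module.End k A)

/-- The action `h · (a ⊗ g) = (h₁ a) ⊗ h₂ g` of `B` on `A ⊗ B`. -/
noncomputable def smashAct : B →ₗ[k] Module.End k (A ⊗[k] B) :=
  TensorProduct.homTensorHomMap (.id k) A B A B ∘ₗ
    TensorProduct.map act.toLinearMap (LinearMap.mul k B) ∘ₗ comul

variable {act} in
theorem smashAct_tmul {ι : Type*} {h : B} (r : Repr k h ι) (a : A) (g : B) :
    smashAct act h (a ⊗ₜ g) = ∑ i ∈ r.index, act (r.left i) a ⊗ₜ (r.right i * g) := by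
  simp [smashAct, ← r.eq]

/-- The multiplication `(a ⊗ h)(a' ⊗ h') = a (h₁ a') ⊗ h₂ h'` on `A ⊗ B`. -/
noncomputable def smashMul : A ⊗[k] B →ₗ[k] Module.End k (A ⊗[k] B) :=
  TensorProduct.lift ((LinearMap.mul k (Module.End k (A ⊗[k] B))).compl₁₂
    (LinearMap.rTensorHom B ∘ₗ LinearMap.mul k A) (smashAct act))

variable {act}

theorem smashMul_tmul (a : A) (h : B) :
    smashMul act (a ⊗ₜ h) = (LinearMap.mulLeft k a).rTensor B * smashAct act h := rfl

theorem smashMul_tmul_tmul {ι : Type*} {h : B} (r : Repr k h ι) (a a' : A) (g : B) :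
    smashMul act (a ⊗ₜ h) (a' ⊗ₜ g) =
      ∑ i ∈ r.index, (a * act (r.left i) a') ⊗ₜ (r.right i * g) := by
  simp [smashMul_tmul, smashAct_tmul r]

theorem smashAct_mul (g h : B) : smashAct act (g * h) = smashAct act g * smashAct act h := by
  ext a b
  simp [smashAct, Bialgebra.comul_mul, ← (ℛ k g).eq, ← (ℛ k h).eq, Finset.sum_mul_sum, mul_assoc]

theorem smashAct_one : smashAct act 1 = 1 := by
  ext a b
  simp [smashAct, Algebra.TensorProduct.one_def]

/-- The action of a bialgebra on an algebra makes it a module algebra: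
`h (x y) = (h₁ x) (h₂ y)` and `h 1 = ε(h) 1`. -/
structure IsModuleAlgebra (act : B →ₐ[k] Module.End k A) : Prop where
  act_mul (h : B) (x y : A) : act h (x * y) = LinearMap.mul' k A
    (TensorProduct.map (act.toLinearMap.flip x) (act.toLinearMap.flip y) (comul h))
  act_one (h : B) : act h 1 = counit (R := k) h • (1 : A)

theorem smashAct_mulLeft (hA : IsModuleAlgebra act) {ι : Type*} {h : B} (r : Repr k h ι) (b : A) :
    smashAct act h * (LinearMap.mulLeft k b).rTensor B =
      ∑ i ∈ r.index, smashMul act (act (r.left i) b ⊗ₜ r.right i) := by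
  ext a g
  simp only [TensorProduct.AlgebraTensorModule.curry_apply, LinearMap.restrictScalars_self,
    TensorProduct.curry_apply, Module.End.mul_apply, LinearMap.rTensor_tmul,
    LinearMap.mulLeft_apply, LinearMap.sum_apply, smashAct_tmul r, hA.act_mul]
  have key := sweedler_assoc (((LinearMap.mul k A).compl₁₂ (act.toLinearMap.flip b)
    (act.toLinearMap.flip a)).compr₂ ((TensorProduct.mk k A B).compl₂ (LinearMap.mulRight k g)))
    r (fun i => ℛ k (r.left i)) (fun i => ℛ k (r.right i))
  refine Eq.trans ?_ (key.trans ?_)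
  · refine Finset.sum_congr rfl fun i _ => ?_
    rw [← (ℛ k (r.left i)).eq]
    simp [TensorProduct.sum_tmul]
  · refine Finset.sum_congr rfl fun i _ => ?_
    rw [smashMul_tmul_tmul (ℛ k (r.right i))]
    simp

theorem mulLeft_smashMul (c : A) (x : A ⊗[k] B) :
    (LinearMap.mulLeft k c).rTensor B * smashMul act x =
      smashMul act ((LinearMap.mulLeft k c).rTensor B x) := by
  induction x with
  | zero => simp
  | add p q hp hq => simp only [map_add, mul_add, hp, hq]
  | tmul a h =>
    rw [LinearMap.rTensor_tmul, smashMul_tmul, smashMul_tmul, ← mul_assoc,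
      LinearMap.mulLeft_apply, LinearMap.mulLeft_mul, LinearMap.rTensor_comp]
    rfl

theorem smashMul_mul_smashAct (x : A ⊗[k] B) (h : B) :
    smashMul act x * smashAct act h =
      smashMul act ((LinearMap.mulRight k h).lTensor A x) := by
  induction x with
  | zero => simp
  | add p q hp hq => simp only [map_add, add_mul, hp, hq]
  | tmul a g =>
    rw [LinearMap.lTensor_tmul, smashMul_tmul, smashMul_tmul, mul_assoc, ← smashAct_mul,
      LinearMap.mulRight_apply]

theorem smashMul_assoc (hA : IsModuleAlgebra act) (x y : A ⊗[k] B) :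
    smashMul act (smashMul act x y) = smashMul act x * smashMul act y := by
  induction x with
  | zero => simp
  | add p q hp hq => simp only [map_add, add_mul, LinearMap.add_apply, hp, hq]
  | tmul a g =>
    induction y with
    | zero => simp
    | add p q hp hq => simp only [map_add, mul_add, hp, hq]
    | tmul b h =>
      rw [smashMul_tmul b h, ← mul_assoc, smashMul_tmul a g, mul_assoc _ (smashAct act g),
        smashAct_mulLeft hA (ℛ k g), Finset.mul_sum, Finset.sum_mul, ← smashMul_tmul,
        smashMul_tmul_tmul (ℛ k g), map_sum]
      refine Finset.sum_congr rfl fun i _ => ?_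
      rw [mulLeft_smashMul, smashMul_mul_smashAct]
      simp

theorem smashMul_one_left : smashMul act (1 ⊗ₜ 1) = 1 := by
  rw [smashMul_tmul, smashAct_one]
  ext
  simp

theorem smashMul_one_right (hA : IsModuleAlgebra act) (x : A ⊗[k] B) :
    smashMul act x (1 ⊗ₜ 1) = x := by
  induction x with
  | zero => simp
  | add p q hp hq => simp only [map_add, LinearMap.add_apply, hp, hq]
  | tmul a h =>
    rw [smashMul_tmul_tmul (ℛ k h)]
    simp only [hA.act_one, mul_one, mul_smul_comm, TensorProduct.smul_tmul,
      ← TensorProduct.tmul_sum]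
    rw [sum_counit_smul (ℛ k h)]

end Smash

section Heisenberg
variable (k : Type*) [Field k] (H : Type*) [Ring H] [HopfAlgebra k H]

/-- The left regular action `(h ▶ ω)(x) = ω(x h)` of `H` on `Ĥ`. -/
noncomputable def regAct : H →ₐ[k] Module.End k (HDual k H) where
  toFun h := (ev k H).symm.toLinearMap ∘ₗ LinearMap.lcomp k k (LinearMap.mulRight k h) ∘ₗ
    (ev k H).toLinearMap
  map_one' := by ext ω : 1; exact dual_ext fun x => by simp
  map_mul' g h := by ext ω : 1; exact dual_ext fun x => by simp [mul_assoc]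
  map_zero' := by ext ω : 1; exact dual_ext fun x => by simp
  map_add' g h := by ext ω : 1; exact dual_ext fun x => by simp [mul_add]
  commutes' c := by
    ext ω : 1
    exact dual_ext fun x => by simp [Algebra.algebraMap_eq_smul_one]

variable {k H} in
@[simp] theorem ev_regAct (h : H) (ω : HDual k H) (x : H) :
    ev k H (regAct k H h ω) x = ev k H ω (x * h) := by simp [regAct]

theorem regAct_isModuleAlgebra : IsModuleAlgebra (regAct k H) where
  act_mul h ω θ := by
    refine dual_ext fun x => ?_
    rw [ev_regAct, ev_mul, Bialgebra.comul_mul]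
    rw [← (ℛ k h).eq, ← (ℛ k x).eq]
    simp only [map_sum, LinearMap.sum_apply, ev_mul_repr (ℛ k x), ev_regAct, Finset.sum_mul_sum,
      TensorProduct.map_tmul, LinearMap.mul'_apply, LinearMap.flip_apply, AlgHom.toLinearMap_apply,
      Algebra.TensorProduct.tmul_mul_tmul]
    rw [Finset.sum_comm]
  act_one h := dual_ext fun x => by simp [mul_comm]

/-- The Heisenberg algebra `𝓗(Ĥ) = Ĥ # H`, the smash product for the left regular action. Its
elements are those of `Ĥ ⊗ H`, see `heisEquiv`, and its multiplication is
`(θ # h)(θ' # h') = θ (h₁ ▶ θ') # h₂ h'`. -/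
def Heisenberg : Type _ := HDual k H ⊗[k] H

noncomputable instance : AddCommGroup (Heisenberg k H) :=
  inferInstanceAs (AddCommGroup (HDual k H ⊗[k] H))

noncomputable instance : Module k (Heisenberg k H) :=
  inferInstanceAs (Module k (HDual k H ⊗[k] H))

/-- The linear identification `θ ⊗ h ↦ θ # h` of `Ĥ ⊗ H` with the Heisenberg algebra. -/
noncomputable def heisEquiv : HDual k H ⊗[k] H ≃ₗ[k] Heisenberg k H := LinearEquiv.refl k _

noncomputable instance : Ring (Heisenberg k H) where
  __ := (inferInstance : AddCommGroup (Heisenberg k H))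
  mul x y := heisEquiv k H
    (smashMul (regAct k H) ((heisEquiv k H).symm x) ((heisEquiv k H).symm y))
  one := heisEquiv k H (1 ⊗ₜ 1)
  mul_assoc x y z := congrArg (fun f => f z) (smashMul_assoc (regAct_isModuleAlgebra k H) x y)
  one_mul x := congrArg (fun f => f x) smashMul_one_left
  mul_one x := smashMul_one_right (regAct_isModuleAlgebra k H) x
  left_distrib x y z := map_add (smashMul (regAct k H) x) y z
  right_distrib x y z := congrArg (fun f => f z) (map_add (smashMul (regAct k H)) x y)
  zero_mul x := congrArg (fun f => f x) (map_zero (smashMul (regAct k H)))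
  mul_zero x := map_zero (smashMul (regAct k H) x)

noncomputable instance : Algebra k (Heisenberg k H) :=
  Algebra.ofModule
    (fun c x y => congrArg (fun f => f y) (map_smul (smashMul (regAct k H)) c x))
    (fun c x y => map_smul (smashMul (regAct k H) x) c y)

variable {k H} in
theorem heis_mul {ι : Type*} {h : H} (r : Repr k h ι) (θ θ' : HDual k H) (h' : H) :
    heisEquiv k H (θ ⊗ₜ h) * heisEquiv k H (θ' ⊗ₜ h') =
      ∑ i ∈ r.index, heisEquiv k H ((θ * regAct k H (r.left i) θ') ⊗ₜ (r.right i * h')) := by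
  rw [← map_sum, ← smashMul_tmul_tmul r]
  rfl

theorem heis_one : heisEquiv k H (1 ⊗ₜ 1) = 1 := rfl

/-- `θ ↦ θ # 1` -/
noncomputable def heisInl : HDual k H →ₐ[k] Heisenberg k H :=
  AlgHom.ofLinearMap ((heisEquiv k H).toLinearMap ∘ₗ (TensorProduct.mk k (HDual k H) H).flip 1) rfl
    (fun x y => by
      let r : Coalgebra.Repr k (1 : H) Unit :=
        { index := {()}, left := fun _ => 1, right := fun _ => 1,
          eq := by simp [Algebra.TensorProduct.one_def] }
      exact Eq.symm ((heis_mul r x y 1).trans (by simp [r])))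

/-- `h ↦ 1 # h` -/
noncomputable def heisInr : H →ₐ[k] Heisenberg k H :=
  AlgHom.ofLinearMap ((heisEquiv k H).toLinearMap ∘ₗ TensorProduct.mk k (HDual k H) H 1) rfl
    (fun x y => by
      refine Eq.symm ((heis_mul (ℛ k x) 1 1 y).trans ?_)
      have := congrArg (fun z => heisEquiv k H (1 ⊗ₜ (z * y))) (sum_counit_smul (ℛ k x))
      simpa [(regAct_isModuleAlgebra k H).act_one, TensorProduct.smul_tmul, Finset.sum_mul,
        TensorProduct.tmul_sum] using this)

end Heisenberg

section YetterDrinfeld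
variable {k : Type*} [Field k] {X B C : Type*} [Ring X] [Algebra k X] [Ring B] [Bialgebra k B]
  [Ring C] [Bialgebra k C]

/-- A left coaction of `B` on the algebra `X`: a unital algebra homomorphism `X → B ⊗ X` that is
coassociative and counital. -/
structure IsLeftCoaction (δ : X →ₗ[k] B ⊗[k] X) : Prop where
  map_one : δ 1 = 1
  map_mul (x y : X) : δ (x * y) = δ x * δ y
  coassoc : TensorProduct.assoc k B B X ∘ₗ (comul (R := k) (A := B)).rTensor X ∘ₗ δ =
    δ.lTensor B ∘ₗ δ
  counital : TensorProduct.lid k X ∘ₗ (counit (R := k) (A := B)).rTensor X ∘ₗ δ = LinearMap.id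

/-- A right coaction of `C` on the algebra `X`: a unital algebra homomorphism `X → X ⊗ C` that is
coassociative and counital. -/
structure IsRightCoaction (β : X →ₗ[k] X ⊗[k] C) : Prop where
  map_one : β 1 = 1
  map_mul (x y : X) : β (x * y) = β x * β y
  coassoc : TensorProduct.assoc k X C C ∘ₗ β.rTensor C ∘ₗ β =
    (comul (R := k) (A := C)).lTensor X ∘ₗ β
  counital : TensorProduct.rid k X ∘ₗ (counit (R := k) (A := C)).lTensor X ∘ₗ β = LinearMap.id

/-- A left action of `B` on the algebra `X` that makes `X` a module algebra:
`b (x y) = (b₁ x) (b₂ y)` and `b 1 = ε(b) 1`. -/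
structure IsLeftAction (act : B →ₗ[k] X →ₗ[k] X) : Prop where
  one_act (x : X) : act 1 x = x
  mul_act (b c : B) (x : X) : act (b * c) x = act b (act c x)
  act_one (b : B) : act b 1 = counit (R := k) b • (1 : X)
  act_mul (b : B) (x y : X) : act b (x * y) =
    LinearMap.mul' k X (TensorProduct.map (act.flip x) (act.flip y) (comul b))

variable (k X) in
/-- `b ⊗ c ↦ b ⊗ 1 ⊗ c` -/
noncomputable def incl13 : B ⊗[k] C →ₐ[k] B ⊗[k] (X ⊗[k] C) :=
  Algebra.TensorProduct.map (AlgHom.id k B) Algebra.TensorProduct.includeRight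

/-- `(X, α, β)` is a left-right Yetter–Drinfeld algebra over `(B, C)`, where `W ∈ B ⊗ C` is the
canonical element of the pairing of `B` with `C`: `α` is a left coaction of `B`, `β` a right
coaction of `C`, and `(α ⊗ id) β = Ad(W₁₃) (id ⊗ β) α`. -/
structure IsLeftRightYD (W : (B ⊗[k] C)ˣ) (α : X →ₗ[k] B ⊗[k] X) (β : X →ₗ[k] X ⊗[k] C) :
    Prop where
  left_coaction : IsLeftCoaction α
  right_coaction : IsRightCoaction β
  compatible (x : X) : TensorProduct.assoc k B X C (α.rTensor C (β x)) =
    Ad k (umap (incl13 k X) W) (β.lTensor B (α x))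

/-- `(X, ▷, δ)` is a left-left Yetter–Drinfeld algebra over `B`: `▷` is a left action and `δ` a
left coaction of `B` on the algebra `X`, and
`h₁ x₋₁ ⊗ (h₂ ▷ x₀) = (h₁ ▷ x)₋₁ h₂ ⊗ (h₁ ▷ x)₀`. -/
structure IsLeftLeftYD (act : B →ₗ[k] X →ₗ[k] X) (δ : X →ₗ[k] B ⊗[k] X) : Prop where
  left_action : IsLeftAction act
  left_coaction : IsLeftCoaction δ
  compatible (h : B) (x : X) :
    TensorProduct.map₂ (LinearMap.mul k B) act (comul h) (δ x) =
      LinearMap.mul' k (B ⊗[k] X) (TensorProduct.map (δ ∘ₗ act.flip x)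
        (Algebra.TensorProduct.includeLeft (R := k) (S := k) (A := B) (B := X)).toLinearMap
        (comul h))

end YetterDrinfeld

section Coactions
variable (k : Type*) [Field k] (H : Type*) [Ring H] [HopfAlgebra k H] [Module.Finite k H]

/-- The linear identification `𝓓(H) → 𝓗(Ĥ)`, `ω ⋈ h ↦ ω # h`. -/
noncomputable def doubleToHeis : DrinfeldDouble k H ≃ₗ[k] Heisenberg k H :=
  (doubleEquiv k H).symm.trans (heisEquiv k H)

/-- The left coaction `Γ' = (id ⊗ L) Δ L⁻¹` of `𝓓(H)` on `𝓗(Ĥ)`, where `L` is the identification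
`doubleToHeis`. -/
noncomputable def leftCoaction : Heisenberg k H →ₗ[k] DrinfeldDouble k H ⊗[k] Heisenberg k H :=
  (doubleToHeis k H).toLinearMap.lTensor (DrinfeldDouble k H) ∘ₗ
    comul ∘ₗ (doubleToHeis k H).symm.toLinearMap

/-- The element `𝕌 = ∑ (1 # hᵢ) ⊗ hⁱ` of `𝓗(Ĥ) ⊗ Ĥ`. -/
noncomputable def heisU : (Heisenberg k H ⊗[k] HDual k H)ˣ :=
  umap (Algebra.TensorProduct.map (heisInr k H) (AlgHom.id k (HDual k H))) (canU k H)

/-- The element `𝕍 = ∑ (hⁱ # 1) ⊗ hᵢᵒᵖ` of `𝓗(Ĥ) ⊗ Hᵒᵖ`. -/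
noncomputable def heisV : (Heisenberg k H ⊗[k] Hᵐᵒᵖ)ˣ :=
  umap ((Algebra.TensorProduct.map (heisInl k H) (AlgHom.id k Hᵐᵒᵖ)).comp
    (Algebra.TensorProduct.comm k Hᵐᵒᵖ (HDual k H)).toAlgHom) (opU k H)

/-- The element `𝕍₁₂ 𝕌₁₃` of `𝓗(Ĥ) ⊗ 𝓣(H) = 𝓗(Ĥ) ⊗ Hᵒᵖ ⊗ Ĥ`. -/
noncomputable def heisUnit : (Heisenberg k H ⊗[k] Codouble k H)ˣ :=
  umap (Algebra.TensorProduct.map (AlgHom.id k (Heisenberg k H))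
    ((codoubleEquiv k H).toAlgHom.comp Algebra.TensorProduct.includeLeft)) (heisV k H) *
  umap (Algebra.TensorProduct.map (AlgHom.id k (Heisenberg k H))
    ((codoubleEquiv k H).toAlgHom.comp Algebra.TensorProduct.includeRight)) (heisU k H)

/-- The right coaction `Γ = Ad(𝕍₁₂ 𝕌₁₃)(· ⊗ 1 ⊗ 1)` of `𝓣(H)` on `𝓗(Ĥ)`. -/
noncomputable def rightCoaction : Heisenberg k H →ₗ[k] Heisenberg k H ⊗[k] Codouble k H :=
  ((Ad k (heisUnit k H)).comp (Algebra.TensorProduct.includeLeft (R := k) (S := k)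
    (A := Heisenberg k H) (B := Codouble k H))).toLinearMap

/-- The left action `d ▷ x = (id ⊗ p_𝓓(d, ·))(Γ(x))` of `𝓓(H)` on `𝓗(Ĥ)`. -/
noncomputable def leftAction : DrinfeldDouble k H →ₗ[k] Heisenberg k H →ₗ[k] Heisenberg k H :=
  LinearMap.mk₂ k (fun d x => TensorProduct.rid k (Heisenberg k H)
      ((ev k (Codouble k H) d).lTensor (Heisenberg k H) (rightCoaction k H x)))
    (by intros; simp only [map_add, LinearMap.lTensor_add, LinearMap.add_apply])
    (by intros; simp only [map_smul, LinearMap.lTensor_smul, LinearMap.smul_apply])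
    (by intros; simp only [map_add])
    (by intros; simp only [map_smul])

variable {k H} in
/-- The coaction `Γ'` written out: `θ # h ↦ (θ₂ ⋈ h₁) ⊗ (θ₁ # h₂)`. -/
theorem leftCoaction_heisEquiv {ι κ : Type*} {θ : HDual k H} {h : H} (r : Repr k θ ι)
    (s : Repr k h κ) :
    leftCoaction k H (heisEquiv k H (θ ⊗ₜ h)) = ∑ i ∈ r.index, ∑ j ∈ s.index,
      doubleEquiv k H (r.right i ⊗ₜ s.left j) ⊗ₜ heisEquiv k H (r.left i ⊗ₜ s.right j) := by
  simp [leftCoaction, doubleToHeis, double_comul_tmul k H r s]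

end Coactions

end HopfYD

/-! Write C = 𝓣(H), D = Ĉ = 𝓓(H), X = 𝓗(Ĥ), let φ : D ≃ X be the linear map ω ⋈ h ↦ ω # h, and call
(id ⊗ d)(t) the slice of t by d ∈ D. Everything rests on one fact: the comultiplication of D,
transported along φ to α = Γ' : X → D ⊗ X, is multiplicative. So X is a cocycle deformation of D on
one side.

The general part uses only this fact, φ(1) = 1 and the canonical element W of D ⊗ C. Applying id ⊗
εφ⁻¹ to α(φ(d)φ(d')) = α(φ(d))α(φ(d')) gives φ(d)φ(d') = σ(d₂, d'₂) φ(d₁d'₁), where σ(d, d') =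
ε(φ⁻¹(φ(d)φ(d'))). For an invertible u ∈ X ⊗ C whose slice by each d is φ(d), this reads u₁₂u₁₃ =
(id ⊗ Δ)(u)(1 ⊗ F), with F ∈ C ⊗ C representing σ. Since 1 ⊗ F commutes with x ⊗ 1 ⊗ 1, conjugation
x ↦ u(x ⊗ 1)u⁻¹ is a coaction β (`adCoaction_coassoc`). Moreover α(φ(d)) = d₁ ⊗ φ(d₂) means (α ⊗
id)(u) = W₁₃u₂₃, and conjugating α(x) ⊗ 1 by this element is the left-right Yetter–Drinfeld
condition (`isLeftRightYD_transport`). Moving W₁₃⁻¹ to the other side and slicing by d gives the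
left-left condition (`IsLeftRightYD.isLeftLeftYD`).

Two facts about the concrete situation remain. The slice of 𝕍₁₂𝕌₁₃ by ω ⋈ a is (ω # 1)(1 # a) = ω #
a, so u = 𝕍₁₂𝕌₁₃ is admissible (`dslice_heisUnit`). And Γ' is multiplicative (`leftCoaction_mul`),
which reduces to the products (1 # h)(θ # 1). There one combines (1 # h)(θ # 1) = (h₁ ▶ θ) # h₂ in X
with the exchange relation (1 ⋈ a₁)(ω(a₂ ·) ⋈ 1) = (a₁ ▶ ω) ⋈ a₂ in D (`double_exchange`); the
latter is the identity Ad(°U)(z) °U = °U z, paired with ω and a. -/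

namespace HopfYD

open Coalgebra HopfAlgebra WithConv LinearMap

/-! ### Sweedler representations of units and products. -/

section Representations
variable {k : Type*} [Field k] {A : Type*} [Ring A] [Bialgebra k A]

variable (k A) in
/-- `Δ(1) = 1 ⊗ 1` -/
def reprOne : Repr k (1 : A) Unit where
  index := {()}
  left _ := 1
  right _ := 1
  eq := by simp [Algebra.TensorProduct.one_def]

/-- `Δ(ab) = a₁b₁ ⊗ a₂b₂` -/
def reprMul {ι κ : Type*} {a b : A} (r : Repr k a ι) (s : Repr k b κ) :
    Repr k (a * b) (ι × κ) where
  index := r.index ×ˢ s.index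
  left i := r.left i.1 * s.left i.2
  right i := r.right i.1 * s.right i.2
  eq := by simp [← r.eq, ← s.eq, Finset.sum_mul_sum, Finset.sum_product]

end Representations

/-! ### Slicing tensors over C by functionals in the dual of C. -/

section Slice
variable {k : Type*} [Field k] {C : Type*} [Ring C] [Bialgebra k C]
  {X Y B : Type*} [Ring X] [Algebra k X] [Ring Y] [Algebra k Y] [Ring B] [Algebra k B]

/-- `x ⊗ c ↦ d(c) x` -/
noncomputable def dslice (d : HDual k C) : X ⊗[k] C →ₗ[k] X :=
  (TensorProduct.rid k X).toLinearMap ∘ₗ (ev k C d).lTensor X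

@[simp] theorem dslice_tmul (d : HDual k C) (x : X) (c : C) :
    dslice d (x ⊗ₜ[k] c) = ev k C d c • x := by simp [dslice]

theorem dslice_rTensor (d : HDual k C) (g : X →ₗ[k] Y) (t : X ⊗[k] C) :
    dslice d (g.rTensor C t) = g (dslice d t) := by
  induction t with
  | zero => simp
  | add p q hp hq => simp only [map_add, hp, hq]
  | tmul p q => simp

theorem lTensor_dslice_assoc (d : HDual k C) (t : (B ⊗[k] X) ⊗[k] C) :
    (dslice d).lTensor B (TensorProduct.assoc k B X C t) = dslice d t := by
  have : (dslice d).lTensor B ∘ₗ (TensorProduct.assoc k B X C).toLinearMap = dslice d := by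
    ext; simp
  exact LinearMap.congr_fun this t

theorem dslice_incl13 {A : Type*} [Ring A] [Bialgebra k A] (d : HDual k C) (w : A ⊗[k] C) :
    (dslice d).lTensor A (incl13 k X w) = dslice d w ⊗ₜ[k] (1 : X) := by
  induction w with
  | zero => simp
  | add p q hp hq => simp only [map_add, TensorProduct.add_tmul, hp, hq]
  | tmul p q => simp [incl13, TensorProduct.smul_tmul]

/-- `x ⊗ c ⊗ c' ↦ d(c) d'(c') x` -/
noncomputable def dslice₂ (d d' : HDual k C) : X ⊗[k] (C ⊗[k] C) →ₗ[k] X :=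
  (TensorProduct.rid k X).toLinearMap ∘ₗ
    (LinearMap.mul' k k ∘ₗ TensorProduct.map (ev k C d) (ev k C d')).lTensor X

@[simp] theorem dslice₂_tmul (d d' : HDual k C) (x : X) (t : C ⊗[k] C) :
    dslice₂ d d' (x ⊗ₜ[k] t) =
      LinearMap.mul' k k (TensorProduct.map (ev k C d) (ev k C d') t) • x := by
  simp [dslice₂]

/-- The product of Ĉ is convolution, that is, dual to Δ. -/
theorem dslice₂_comul (d d' : HDual k C) (t : X ⊗[k] C) :
    dslice₂ d d' ((comul (R := k) (A := C)).lTensor X t) = dslice (d * d') t := by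
  induction t with
  | zero => simp
  | add p q hp hq => simp only [map_add, hp, hq]
  | tmul p q => simp [ev_mul]

/-- The outer leg is sliced before the inner one; for a right coaction this is the order of
composition in a left module. -/
theorem dslice₂_assoc (d d' : HDual k C) (t : (X ⊗[k] C) ⊗[k] C) :
    dslice₂ d d' (TensorProduct.assoc k X C C t) = dslice d (dslice d' t) := by
  have : dslice₂ d d' ∘ₗ (TensorProduct.assoc k X C C).toLinearMap = dslice d ∘ₗ dslice d' := by
    ext; simp [mul_comm, smul_smul]
  exact LinearMap.congr_fun this t

variable (k X C) in
/-- `x ⊗ c ↦ x ⊗ c ⊗ 1` -/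
noncomputable def incl12 : X ⊗[k] C →ₐ[k] X ⊗[k] (C ⊗[k] C) :=
  Algebra.TensorProduct.map (AlgHom.id k X) Algebra.TensorProduct.includeLeft

/-- The C-legs sit in different places, so only the product of X remains. This turns u₁₂u₁₃ into the
products φ(d)φ(d'). -/
theorem dslice₂_incl12_mul_incl13 (d d' : HDual k C) (s t : X ⊗[k] C) :
    dslice₂ d d' (incl12 k C X s *
      Algebra.TensorProduct.map (AlgHom.id k X) Algebra.TensorProduct.includeRight t) =
      dslice d s * dslice d' t := by
  induction s with
  | zero => simp
  | add p q hp hq => simp only [map_add, add_mul, hp, hq]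
  | tmul p q =>
    induction t with
    | zero => simp
    | add p q hp hq => simp only [map_add, mul_add, hp, hq]
    | tmul p q => simp [incl12, smul_smul, mul_comm]

variable [Module.Finite k C]

/-- As C is finite-dimensional, a tensor is recovered from its slices by a dual basis. The
identities between implementing elements are checked on slices in this way. -/
theorem dslice_ext {s t : X ⊗[k] C} (h : ∀ d : HDual k C, dslice d s = dslice d t) : s = t := by
  let b := Module.finBasis k C
  have key : ∀ s : X ⊗[k] C, s = ∑ i, dslice ((ev k C).symm (b.coord i)) s ⊗ₜ[k] b i := by
    intro s
    induction s with
    | zero => simp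
    | add p q hp hq =>
      simp only [map_add, TensorProduct.add_tmul, Finset.sum_add_distrib, ← hp, ← hq]
    | tmul x c =>
      simp only [dslice_tmul, LinearEquiv.apply_symm_apply, TensorProduct.smul_tmul,
        ← TensorProduct.tmul_sum]
      exact congrArg (x ⊗ₜ[k] ·) (b.sum_repr c).symm
  rw [key s, key t]
  simp only [h]

/-- The comultiplication of Ĉ is dual to the product of C. -/
theorem dslice_mul {ι : Type*} {d : HDual k C} (r : Repr k d ι) (s t : X ⊗[k] C) :
    dslice d (s * t) = ∑ i ∈ r.index, dslice (r.left i) s * dslice (r.right i) t := by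
  induction s with
  | zero => simp
  | add p q hp hq => simp only [add_mul, map_add, hp, hq, Finset.sum_add_distrib]
  | tmul p q =>
    induction t with
    | zero => simp
    | add p q hp hq => simp only [mul_add, map_add, hp, hq, Finset.sum_add_distrib]
    | tmul p' q' =>
      simp only [Algebra.TensorProduct.tmul_mul_tmul, dslice_tmul, ← dual_comul_repr r,
        Finset.sum_smul]
      exact Finset.sum_congr rfl fun i _ => (smul_mul_smul_comm _ _ _ _).symm

theorem lTensor_dslice_ext {s t : B ⊗[k] (X ⊗[k] C)}
    (h : ∀ d : HDual k C, (dslice d).lTensor B s = (dslice d).lTensor B t) : s = t := by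
  apply (TensorProduct.assoc k B X C).symm.injective
  refine dslice_ext fun d => ?_
  have := h d
  rw [← (TensorProduct.assoc k B X C).apply_symm_apply s,
    ← (TensorProduct.assoc k B X C).apply_symm_apply t, lTensor_dslice_assoc,
    lTensor_dslice_assoc] at this
  exact this

theorem lTensor_dslice_mul {ι : Type*} {d : HDual k C} (r : Repr k d ι)
    (s t : B ⊗[k] (X ⊗[k] C)) : (dslice d).lTensor B (s * t) =
      ∑ i ∈ r.index, (dslice (r.left i)).lTensor B s * (dslice (r.right i)).lTensor B t := by
  induction s with
  | zero => simp
  | add p q hp hq => simp only [add_mul, map_add, hp, hq, Finset.sum_add_distrib]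
  | tmul p q =>
    induction t with
    | zero => simp
    | add p q hp hq => simp only [mul_add, map_add, hp, hq, Finset.sum_add_distrib]
    | tmul p' q' =>
      simp [dslice_mul r, TensorProduct.tmul_sum]

/-- Multiplicativity of slices in both C-legs. The factor F has no X-component, so it contributes
only the scalars F(d₂, d'₂), matching the cocycle in `mul_eq_sum_smul`. -/
theorem dslice₂_mul_tmul {ι κ : Type*} {d d' : HDual k C} (r : Repr k d ι) (r' : Repr k d' κ)
    (s : X ⊗[k] (C ⊗[k] C)) (F : C ⊗[k] C) :
    dslice₂ d d' (s * (1 ⊗ₜ F)) = ∑ i ∈ r.index, ∑ j ∈ r'.index,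
      LinearMap.mul' k k (TensorProduct.map (ev k C (r.right i)) (ev k C (r'.right j)) F) •
        dslice₂ (r.left i) (r'.left j) s := by
  induction s with
  | zero => simp
  | add p q hp hq => simp only [add_mul, map_add, hp, hq, smul_add, Finset.sum_add_distrib]
  | tmul x t =>
    induction t with
    | zero => simp
    | add p q hp hq =>
      simp only [TensorProduct.tmul_add, add_mul, map_add, hp, hq, smul_add,
        Finset.sum_add_distrib]
    | tmul c c' =>
      induction F with
      | zero => simp
      | add p q hp hq =>
        simp only [TensorProduct.tmul_add, mul_add, map_add, hp, hq, add_smul,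
          Finset.sum_add_distrib]
      | tmul e e' =>
        simp only [Algebra.TensorProduct.tmul_mul_tmul, mul_one, dslice₂_tmul,
          TensorProduct.map_tmul, LinearMap.mul'_apply, ← dual_comul_repr r, ← dual_comul_repr r',
          Finset.sum_mul_sum, Finset.sum_smul, smul_smul]
        refine Finset.sum_congr rfl fun i _ => Finset.sum_congr rfl fun j _ => ?_
        congr 1
        ring

theorem dslice₂_ext {s t : X ⊗[k] (C ⊗[k] C)}
    (h : ∀ d d' : HDual k C, dslice₂ d d' s = dslice₂ d d' t) : s = t := by
  apply (TensorProduct.assoc k X C C).symm.injective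
  refine dslice_ext fun d' => dslice_ext fun d => ?_
  have := h d d'
  rw [← (TensorProduct.assoc k X C C).apply_symm_apply s,
    ← (TensorProduct.assoc k X C C).apply_symm_apply t, dslice₂_assoc, dslice₂_assoc] at this
  exact this

/-- Every bilinear form on `Ĉ` is given by an element of `C ⊗ C`. -/
theorem exists_tensor_of_bilin (σ : HDual k C →ₗ[k] HDual k C →ₗ[k] k) : ∃ F : C ⊗[k] C,
    ∀ d d', LinearMap.mul' k k (TensorProduct.map (ev k C d) (ev k C d') F) = σ d d' := by
  let b := Module.finBasis k C
  -- The coefficients are the values of σ on the dual basis.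
  refine ⟨∑ i, ∑ j, σ ((ev k C).symm (b.coord i)) ((ev k C).symm (b.coord j)) • (b i ⊗ₜ b j),
    fun d d' => ?_⟩
  have hb : ∀ d : HDual k C, d = ∑ i, ev k C d (b i) • (ev k C).symm (b.coord i) := by
    intro d
    refine dual_ext fun x => ?_
    conv_lhs => rw [← b.sum_repr x]
    simp
  conv_rhs => rw [hb d, hb d']
  simp only [map_sum, map_smul, LinearMap.sum_apply, LinearMap.smul_apply, TensorProduct.map_tmul,
    LinearMap.mul'_apply, smul_eq_mul, Finset.mul_sum]
  rw [Finset.sum_comm]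
  exact Finset.sum_congr rfl fun i _ => Finset.sum_congr rfl fun j _ => by ring

end Slice

/-! ### Coactions implemented by conjugation with an invertible element. -/

section AdCoaction
variable {k : Type*} [Field k] {C : Type*} [Ring C] [Bialgebra k C]
  {X : Type*} [Ring X] [Algebra k X]

/-- `x ↦ u (x ⊗ 1) u⁻¹` -/
noncomputable def adCoaction (u : (X ⊗[k] C)ˣ) : X →ₐ[k] X ⊗[k] C :=
  (Ad k u).comp (Algebra.TensorProduct.includeLeft (R := k) (S := k) (A := X) (B := C))

theorem adCoaction_apply (u : (X ⊗[k] C)ˣ) (x : X) :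
    adCoaction u x = (u : X ⊗[k] C) * (x ⊗ₜ[k] (1 : C)) * (↑u⁻¹ : X ⊗[k] C) := rfl

/-- The map id ⊗ ε is an algebra homomorphism, so it turns conjugation by u into conjugation by (id
⊗ ε)(u) = 1. -/
theorem adCoaction_counital {u : (X ⊗[k] C)ˣ}
    (hu : TensorProduct.rid k X ((counit (R := k) (A := C)).lTensor X (u : X ⊗[k] C)) = 1) :
    TensorProduct.rid k X ∘ₗ (counit (R := k) (A := C)).lTensor X ∘ₗ (adCoaction u).toLinearMap =
      LinearMap.id := by
  let e : X ⊗[k] C →ₐ[k] X := (Algebra.TensorProduct.rid k k X).toAlgHom.comp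
    (Algebra.TensorProduct.map (AlgHom.id k X) (Bialgebra.counitAlgHom k C))
  have h1 : umap e u = 1 := Units.ext hu
  ext x
  have h2 : e (adCoaction u x) = Ad k (umap e u) (e (x ⊗ₜ 1)) := by
    simp [adCoaction_apply]
  refine Eq.trans h2 ?_
  rw [h1]
  simp [e]

/-- Both iterated coactions conjugate x ⊗ 1 ⊗ 1, one by u₁₂u₁₃ and the other by (id ⊗ Δ)(u). These
elements differ by a right factor 1 ⊗ F, which commutes with x ⊗ 1 ⊗ 1. -/
theorem adCoaction_coassoc {u : (X ⊗[k] C)ˣ} {F : C ⊗[k] C}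
    (hF : incl12 k C X u *
      Algebra.TensorProduct.map (AlgHom.id k X) Algebra.TensorProduct.includeRight
        (u : X ⊗[k] C) = (comul (R := k) (A := C)).lTensor X (u : X ⊗[k] C) * (1 ⊗ₜ F)) :
    TensorProduct.assoc k X C C ∘ₗ (adCoaction u).toLinearMap.rTensor C ∘ₗ
      (adCoaction u).toLinearMap =
        (comul (R := k) (A := C)).lTensor X ∘ₗ (adCoaction u).toLinearMap := by
  let i13 : X ⊗[k] C →ₐ[k] X ⊗[k] (C ⊗[k] C) :=
    Algebra.TensorProduct.map (AlgHom.id k X) Algebra.TensorProduct.includeRight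
  let Dl : X ⊗[k] C →ₐ[k] X ⊗[k] (C ⊗[k] C) :=
    Algebra.TensorProduct.map (AlgHom.id k X) (Bialgebra.comulAlgHom k C)
  let v := umap (incl12 k C X) u * umap i13 u
  let y := umap Dl u
  have hv : (v : X ⊗[k] (C ⊗[k] C)) =
      (y : X ⊗[k] (C ⊗[k] C)) * ((1 : X) ⊗ₜ[k] F) := hF
  -- Applying the coaction to the X-leg inserts a unit in the middle and conjugates by u₁₂.
  have hl : ∀ z : X ⊗[k] C, TensorProduct.assoc k X C C
      ((adCoaction u).toLinearMap.rTensor C z) = Ad k (umap (incl12 k C X) u) (i13 z) := by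
    intro z
    let as := Algebra.TensorProduct.assoc k k k X C C
    have h12 : ∀ w : X ⊗[k] C, as (w ⊗ₜ 1) = incl12 k C X w := by
      intro w
      induction w with
      | zero => simp
      | add p q hp hq => simp only [map_add, TensorProduct.add_tmul, hp, hq]
      | tmul p q => simp [as, incl12]
    induction z with
    | zero => simp
    | add p q hp hq => simp only [map_add, hp, hq]
    | tmul x c =>
      have h1 : (adCoaction u x) ⊗ₜ[k] c = ((u : X ⊗[k] C) ⊗ₜ[k] (1 : C)) *
        ((x ⊗ₜ 1) ⊗ₜ c) * ((↑u⁻¹ : X ⊗[k] C) ⊗ₜ[k] (1 : C)) := by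
        simp [adCoaction_apply]
      rw [LinearMap.rTensor_tmul]
      refine (congrArg as h1).trans ?_
      rw [map_mul, map_mul, h12, h12]
      simp [as, i13]
  ext x
  simp only [LinearMap.comp_apply, LinearEquiv.coe_coe, hl]
  have h1 : i13 (adCoaction u x) = Ad k (umap i13 u) (x ⊗ₜ 1) := by
    simp [adCoaction_apply, i13, Algebra.TensorProduct.one_def]
  have h2 : Dl (adCoaction u x) = Ad k y (x ⊗ₜ 1) := by
    simp [adCoaction_apply, y, Dl, Algebra.TensorProduct.one_def]
  have h3 : Ad k (umap (incl12 k C X) u) (Ad k (umap i13 u) (x ⊗ₜ 1)) = Ad k v (x ⊗ₜ 1) := by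
    simp [v, mul_assoc]
  -- With v = y(1 ⊗ F): move x ⊗ 1 ⊗ 1 past 1 ⊗ F, then replace 1 ⊗ F by y⁻¹v. No inverse of F is
  -- needed.
  have h4 : (v : X ⊗[k] (C ⊗[k] C)) * (x ⊗ₜ 1) =
      (y : X ⊗[k] (C ⊗[k] C)) * (x ⊗ₜ 1) * (↑y⁻¹ : X ⊗[k] (C ⊗[k] C)) *
        (v : X ⊗[k] (C ⊗[k] C)) := by
    rw [hv]
    simp [mul_assoc]
  refine (congrArg (Ad k _) h1).trans (h3.trans (Eq.trans ?_ h2.symm))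
  rw [Ad_apply, Ad_apply, Units.mul_inv_eq_iff_eq_mul, h4]

end AdCoaction

/-! ### Yetter–Drinfeld algebras from a transported comultiplication. -/

section Cleft
variable {k : Type*} [Field k] {C : Type*} [Ring C] [Bialgebra k C] [Module.Finite k C]
  {X : Type*} [Ring X] [Algebra k X]

variable (φ : HDual k C ≃ₗ[k] X)

/-- The left coaction `(id ⊗ φ) Δ φ⁻¹` obtained by transporting the comultiplication of `Ĉ`. -/
noncomputable def transportCoaction : X →ₗ[k] HDual k C ⊗[k] X :=
  φ.toLinearMap.lTensor (HDual k C) ∘ₗ comul ∘ₗ φ.symm.toLinearMap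

variable {φ}

theorem transportCoaction_repr {ι : Type*} {d : HDual k C} (r : Repr k d ι) :
    transportCoaction φ (φ d) = ∑ i ∈ r.index, r.left i ⊗ₜ φ (r.right i) := by
  simp [transportCoaction, ← r.eq]

/-- Coassociativity and the counit law are those of Ĉ carried along φ; compatibility with the
product of X is the only real condition. -/
theorem transportCoaction_isLeftCoaction (h1 : φ 1 = 1)
    (hmul : ∀ x y, transportCoaction φ (x * y) = transportCoaction φ x * transportCoaction φ y) :
    IsLeftCoaction (transportCoaction φ) where
  map_one := by
    have := transportCoaction_repr (φ := φ) (reprOne k (HDual k C))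
    simpa [reprOne, h1, Algebra.TensorProduct.one_def] using this
  map_mul := hmul
  coassoc := by
    ext x
    obtain ⟨d, rfl⟩ := φ.surjective x
    simp only [LinearMap.comp_apply, LinearEquiv.coe_coe]
    have e1 : ∀ t : HDual k C ⊗[k] HDual k C, TensorProduct.assoc k _ _ _
        ((comul (R := k) (A := HDual k C)).rTensor X (φ.toLinearMap.lTensor (HDual k C) t)) =
        (φ.toLinearMap.lTensor (HDual k C)).lTensor (HDual k C)
          (TensorProduct.assoc k _ _ _ ((comul (R := k)).rTensor (HDual k C) t)) := by
      intro t
      induction t with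
      | zero => simp
      | add p q hp hq => simp only [map_add, hp, hq]
      | tmul p q =>
        simp only [LinearMap.lTensor_tmul, LinearMap.rTensor_tmul, ← (ℛ k p).eq,
          TensorProduct.sum_tmul, map_sum, TensorProduct.assoc_tmul, LinearEquiv.coe_coe]
    have e2 : ∀ t : HDual k C ⊗[k] HDual k C, (transportCoaction φ).lTensor (HDual k C)
        (φ.toLinearMap.lTensor (HDual k C) t) =
        (φ.toLinearMap.lTensor (HDual k C)).lTensor (HDual k C)
          ((comul (R := k)).lTensor (HDual k C) t) := by
      intro t
      induction t with
      | zero => simp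
      | add p q hp hq => simp only [map_add, hp, hq]
      | tmul p q => simp [transportCoaction]
    have e3 : transportCoaction φ (φ d) = φ.toLinearMap.lTensor (HDual k C) (comul d) := by
      simp [transportCoaction]
    rw [e3, e1, e2, coassoc_apply]
  counital := by
    ext x
    obtain ⟨d, rfl⟩ := φ.surjective x
    have := congrArg φ (sum_counit_smul (ℛ k d))
    simp only [LinearMap.comp_apply, LinearEquiv.coe_coe, transportCoaction_repr (ℛ k d)]
    simpa using this

/-- The product of X is that of Ĉ deformed by the bilinear form σ(d, d') = ε(φ⁻¹(φ(d)φ(d'))). This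
is obtained from multiplicativity of the coaction by applying the functional εφ⁻¹ to the X-leg. -/
theorem mul_eq_sum_smul
    (hmul : ∀ x y, transportCoaction φ (x * y) = transportCoaction φ x * transportCoaction φ y)
    {ι κ : Type*} {d d' : HDual k C} (r : Repr k d ι) (r' : Repr k d' κ) :
    φ d * φ d' = ∑ i ∈ r.index, ∑ j ∈ r'.index,
      counit (R := k) (φ.symm (φ (r.right i) * φ (r'.right j))) • φ (r.left i * r'.left j) := by
  have h1 := congrArg ((TensorProduct.rid k _).toLinearMap ∘ₗ
    (counit ∘ₗ φ.symm.toLinearMap).lTensor (HDual k C)) (hmul (φ d) (φ d'))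
  rw [transportCoaction_repr r, transportCoaction_repr r', Finset.sum_mul_sum] at h1
  obtain ⟨e, he⟩ := φ.surjective (φ d * φ d')
  -- The functional undoes the coaction on φ(e): e₁ ε(e₂) = e.
  have h2 : (TensorProduct.rid k _) ((counit ∘ₗ φ.symm.toLinearMap).lTensor (HDual k C)
      (transportCoaction φ (φ d * φ d'))) = e := by
    have := sum_tmul_counit_eq (ℛ k e)
    have := congrArg (TensorProduct.rid k (HDual k C)) this
    rw [← he, transportCoaction_repr (ℛ k e)]
    simpa only [map_sum, LinearMap.lTensor_tmul, LinearMap.comp_apply, LinearEquiv.coe_coe,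
      LinearEquiv.symm_apply_apply, TensorProduct.rid_tmul, one_smul] using this
  have h3 := congrArg φ (h2.symm.trans h1)
  rw [he] at h3
  rw [h3]
  simp

/-- If transporting the comultiplication along `φ : Ĉ ≃ X` gives a coaction on the algebra `X`,
then the canonical element of `φ` implements a Yetter–Drinfeld structure on `X`. -/
theorem isLeftRightYD_transport {W : (HDual k C ⊗[k] C)ˣ}
    (hW : ∀ d, dslice d (W : HDual k C ⊗[k] C) = d) {u : (X ⊗[k] C)ˣ}
    (hu : ∀ d, dslice d (u : X ⊗[k] C) = φ d) (h1 : φ 1 = 1)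
    (hmul : ∀ x y, transportCoaction φ (x * y) = transportCoaction φ x * transportCoaction φ y) :
    IsLeftRightYD W (transportCoaction φ) (adCoaction u).toLinearMap where
  left_coaction := transportCoaction_isLeftCoaction h1 hmul
  right_coaction :=
    { map_one := map_one (adCoaction u)
      map_mul := map_mul (adCoaction u)
      coassoc := by
        -- F represents σ. The double slice of u₁₂u₁₃ = (id ⊗ Δ)(u)(1 ⊗ F) by (d, d') is then
        -- exactly `mul_eq_sum_smul`.
        obtain ⟨F, hF⟩ := exists_tensor_of_bilin (((LinearMap.mul k X).compl₁₂ φ.toLinearMap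
          φ.toLinearMap).compr₂ (counit ∘ₗ φ.symm.toLinearMap))
        refine adCoaction_coassoc (F := F) (dslice₂_ext fun d d' => ?_)
        rw [dslice₂_incl12_mul_incl13, hu, hu, dslice₂_mul_tmul (ℛ k d) (ℛ k d'),
          mul_eq_sum_smul hmul (ℛ k d) (ℛ k d')]
        simp only [hF, dslice₂_comul, hu]
        rfl
      -- The unit of Ĉ is the counit of C, so (id ⊗ ε)(u) is the slice of u by 1, namely φ(1).
      counital := adCoaction_counital ((hu 1).trans h1) }
  compatible x := by
    let α := transportCoaction φ
    let D := HDual k C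
    let αh : X →ₐ[k] D ⊗[k] X := AlgHom.ofLinearMap α
      (transportCoaction_isLeftCoaction h1 hmul).map_one hmul
    let αC : X ⊗[k] C →ₐ[k] D ⊗[k] (X ⊗[k] C) :=
      (Algebra.TensorProduct.assoc k k k D X C).toAlgHom.comp
        (Algebra.TensorProduct.map αh (AlgHom.id k C))
    let i23 : X ⊗[k] C →ₐ[k] D ⊗[k] (X ⊗[k] C) := Algebra.TensorProduct.includeRight
    have hαC : ∀ t, αC t = TensorProduct.assoc k D X C (α.rTensor C t) := fun t => rfl
    -- Here (α ⊗ id)(u) = W₁₃u₂₃: the slices by d are α(φ(d)) on the left and d₁ ⊗ φ(d₂) on the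
    -- right.
    have hu' : umap αC u = umap (incl13 k X) W * umap i23 u := by
      refine Units.ext (lTensor_dslice_ext fun d => ?_)
      rw [umap_coe, hαC, lTensor_dslice_assoc, dslice_rTensor, hu, Units.val_mul,
        lTensor_dslice_mul (ℛ k d)]
      simp only [umap_coe, dslice_incl13, hW]
      rw [transportCoaction_repr (ℛ k d)]
      refine Finset.sum_congr rfl fun i _ => ?_
      simp [i23, hu]
    -- The map id ⊗ β is conjugation by u₂₃.
    have hβ : ∀ z : D ⊗[k] X, (adCoaction u).toLinearMap.lTensor D z =
        Ad k (umap i23 u) (TensorProduct.assoc k D X C (z ⊗ₜ 1)) := by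
      intro z
      induction z with
      | zero => simp
      | add p q hp hq => simp only [map_add, TensorProduct.add_tmul, hp, hq]
      | tmul p q => simp [adCoaction_apply, i23]
    -- Since α ⊗ id is an algebra homomorphism, it sends u(x ⊗ 1)u⁻¹ to the conjugate of α(x) ⊗ 1 by
    -- (α ⊗ id)(u). By the factorisation above this is Ad(W₁₃) Ad(u₂₃).
    have e1 : αC (adCoaction u x) = Ad k (umap αC u) (αC (x ⊗ₜ 1)) := by
      simp [adCoaction_apply]
    refine e1.trans ?_
    rw [hu', hβ]
    simp [hαC, α, mul_assoc]

/-- The left action `d ▷ x = (id ⊗ d)(β(x))` of `Ĉ` obtained from a right coaction of `C`. -/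
noncomputable def actOfCoaction (β : X →ₗ[k] X ⊗[k] C) : HDual k C →ₗ[k] X →ₗ[k] X :=
  LinearMap.mk₂ k (fun d x => TensorProduct.rid k X ((ev k C d).lTensor X (β x)))
    (by intros; simp only [map_add, LinearMap.lTensor_add, LinearMap.add_apply])
    (by intros; simp only [map_smul, LinearMap.lTensor_smul, LinearMap.smul_apply])
    (by intros; simp only [map_add])
    (by intros; simp only [map_smul])

omit [Module.Finite k C] in
theorem actOfCoaction_apply (β : X →ₗ[k] X ⊗[k] C) (d : HDual k C) (x : X) :
    actOfCoaction β d x = dslice d (β x) := rfl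

/-- Duality: coassociativity and the counit law of β give the module axioms, while multiplicativity
and unitality of β give the module algebra axioms. -/
theorem IsRightCoaction.isLeftAction {β : X →ₗ[k] X ⊗[k] C} (hβ : IsRightCoaction β) :
    IsLeftAction (actOfCoaction β) where
  one_act x := LinearMap.congr_fun hβ.counital x
  mul_act b c x := by
    have := congrArg (dslice₂ b c) (LinearMap.congr_fun hβ.coassoc x)
    simp only [LinearMap.comp_apply, LinearEquiv.coe_coe, dslice₂_comul, dslice₂_assoc,
      dslice_rTensor] at this
    exact this.symm
  act_one b := by
    rw [actOfCoaction_apply, hβ.map_one, Algebra.TensorProduct.one_def, dslice_tmul]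
    rfl
  act_mul b x y := by
    rw [actOfCoaction_apply, hβ.map_mul, dslice_mul (ℛ k b)]
    conv_rhs => rw [← (ℛ k b).eq]
    simp [actOfCoaction_apply]

/-- A left-right Yetter–Drinfeld algebra over `(Ĉ, C)` is a left-left one over `Ĉ`. -/
theorem IsLeftRightYD.isLeftLeftYD {W : (HDual k C ⊗[k] C)ˣ}
    (hW : ∀ d, dslice d (W : HDual k C ⊗[k] C) = d) {α : X →ₗ[k] HDual k C ⊗[k] X}
    {β : X →ₗ[k] X ⊗[k] C} (h : IsLeftRightYD W α β) : IsLeftLeftYD (actOfCoaction β) α where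
  left_action := h.right_coaction.isLeftAction
  left_coaction := h.left_coaction
  compatible d x := by
    have hc := h.compatible x
    -- Moving W₁₃⁻¹ across leaves (α ⊗ id)(β(x)) W₁₃ = W₁₃ (id ⊗ β)(α(x)), in which only W is to be
    -- sliced. The slice by d reads α(d₁ ▷ x)(d₂ ⊗ 1) = (d₁ ⊗ 1)(id ⊗ d₂ ▷)(α(x)).
    rw [Ad_apply, Units.eq_mul_inv_iff_mul_eq] at hc
    have hd := congrArg ((dslice d).lTensor (HDual k C)) hc
    rw [lTensor_dslice_mul (ℛ k d), lTensor_dslice_mul (ℛ k d)] at hd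
    simp only [lTensor_dslice_assoc, dslice_rTensor, umap_coe, dslice_incl13, hW] at hd
    have e : ∀ (d : HDual k C) (z : HDual k C ⊗[k] X),
        (dslice d).lTensor (HDual k C) (β.lTensor (HDual k C) z) =
          (actOfCoaction β d).lTensor (HDual k C) z := by
      intro d z
      rw [← LinearMap.comp_apply, ← LinearMap.lTensor_comp]
      rfl
    have e' : ∀ (d d' : HDual k C) (z : HDual k C ⊗[k] X),
        (d ⊗ₜ[k] (1 : X)) * (actOfCoaction β d').lTensor (HDual k C) z =
          TensorProduct.map (LinearMap.mul k (HDual k C) d) (actOfCoaction β d') z := by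
      intro d d' z
      induction z with
      | zero => simp
      | add p q hp hq => simp only [map_add, mul_add, hp, hq]
      | tmul p q => simp
    simp only [e, e'] at hd
    rw [← (ℛ k d).eq]
    simp only [map_sum, LinearMap.sum_apply, TensorProduct.map₂_apply_tmul, TensorProduct.map_tmul,
      LinearMap.mul'_apply]
    exact hd.symm

end Cleft

/-! ### The product of the Drinfeld double. -/

section DoubleMul
variable {k : Type*} [Field k] {H : Type*} [Ring H] [HopfAlgebra k H] [Module.Finite k H]

/-- The pairing for arbitrary tensors z; this form is needed because Ad(°U) does not preserve
elementary tensors. -/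
theorem ev_doubleEquiv_codoubleEquiv (ω : HDual k H) (a : H) (z : Hᵐᵒᵖ ⊗[k] HDual k H) :
    ev k (Codouble k H) (doubleEquiv k H (ω ⊗ₜ a)) (codoubleEquiv k H z) =
      ev k H ω (toHom k H Hᵐᵒᵖ z a).unop := by
  induction z with
  | zero => simp
  | add p q hp hq => simp only [map_add, LinearMap.add_apply, MulOpposite.unop_add, hp, hq]
  | tmul c θ =>
    induction c using MulOpposite.rec' with | _ c => ?_
    simp [ev_doubleEquiv, mul_comm]

theorem double_ext {d d' : DrinfeldDouble k H} (h : ∀ (c : H) (θ : HDual k H),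
    ev k (Codouble k H) d (codoubleEquiv k H (MulOpposite.op c ⊗ₜ θ)) =
      ev k (Codouble k H) d' (codoubleEquiv k H (MulOpposite.op c ⊗ₜ θ))) : d = d' := by
  refine dual_ext fun x => ?_
  obtain ⟨x, rfl⟩ := (codoubleEquiv k H).surjective x
  induction x with
  | zero => simp
  | add p q hp hq => simp only [map_add, hp, hq]
  | tmul c θ =>
    induction c using MulOpposite.rec' with | _ c => ?_
    exact h c θ

/-- Evaluate Ad(°U)(z) °U = °U z at a. The dual leg multiplies by convolution and the op leg in
reversed order, and °U evaluates to op. In this form no inverse antipode occurs. -/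
theorem toHom_Ad_opU {ι : Type*} {a : H} (r : Repr k a ι) (z : Hᵐᵒᵖ ⊗[k] HDual k H) :
    ∑ i ∈ r.index, r.right i * (toHom k H Hᵐᵒᵖ (Ad k (opU k H) z) (r.left i)).unop =
      ∑ i ∈ r.index, (toHom k H Hᵐᵒᵖ z (r.right i)).unop * r.left i := by
  have h1 : Ad k (opU k H) z * (opU k H : Hᵐᵒᵖ ⊗[k] HDual k H) =
      (opU k H : Hᵐᵒᵖ ⊗[k] HDual k H) * z := by simp [mul_assoc]
  have h2 := congrArg (fun t => (toHom k H Hᵐᵒᵖ t a).unop) h1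
  simpa only [toHom_mul _ _ r, toHom_opU, Finset.unop_sum, MulOpposite.unop_mul,
    MulOpposite.unop_op] using h2

/-- The case a = 1 of `toHom_Ad_opU`, where Δ(1) = 1 ⊗ 1 makes the twist disappear. -/
theorem toHom_Ad_opU_one (z : Hᵐᵒᵖ ⊗[k] HDual k H) :
    toHom k H Hᵐᵒᵖ (Ad k (opU k H) z) 1 = toHom k H Hᵐᵒᵖ z 1 := by
  apply MulOpposite.unop_injective
  simpa only [reprOne, Finset.sum_singleton, one_mul, mul_one] using toHom_Ad_opU (reprOne k H) z

/-- Applying the character ε to `toHom_Ad_opU` leaves scalar factors ε(a₂) and ε(a₁), which the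
counit law absorbs. -/
theorem counit_toHom_Ad_opU (z : Hᵐᵒᵖ ⊗[k] HDual k H) (a : H) :
    counit (R := k) (toHom k H Hᵐᵒᵖ (Ad k (opU k H) z) a).unop =
      counit (R := k) (toHom k H Hᵐᵒᵖ z a).unop := by
  have h := congrArg (counit (R := k)) (toHom_Ad_opU (ℛ k a) z)
  have e1 := congrArg (fun b => counit (R := k) (toHom k H Hᵐᵒᵖ (Ad k (opU k H) z) b).unop)
    (congrArg (TensorProduct.rid k H) (sum_tmul_counit_eq (ℛ k a)))
  have e2 := congrArg (fun b => counit (R := k) (toHom k H Hᵐᵒᵖ z b).unop)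
    (sum_counit_smul (ℛ k a))
  simp only [map_sum, Bialgebra.counit_mul] at h
  simp only [map_sum, TensorProduct.rid_tmul, one_smul, map_smul, Finset.unop_sum,
    MulOpposite.unop_smul, smul_eq_mul] at e1 e2
  rw [← e1, ← e2, h]
  exact Finset.sum_congr rfl fun i _ => mul_comm _ _

theorem mul_legJ_add {A T B : Type*} [Ring A] [Ring T] [Ring B] [HopfAlgebra k A]
    [HopfAlgebra k T] [HopfAlgebra k B] {iA : A →ₐc[k] B} {iT : T →ₐc[k] B} (x : B ⊗[k] B)
    (p q : A ⊗[k] T) : x * legJ iA iT (p + q) = x * legJ iA iT p + x * legJ iA iT q := by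
  rw [map_add, mul_add]

/-- Because `legJ` flips, c is joined with the dual leg of z in the first factor, and the op leg of
z with θ in the second. Hence z is seen by a and ω' only. -/
theorem ev₂_legJ_incl (z : Hᵐᵒᵖ ⊗[k] HDual k H) (c : Hᵐᵒᵖ) (θ : HDual k H) (ω ω' : HDual k H)
    (a a' : H) : ev₂ k (Codouble k H) (Codouble k H)
      (doubleEquiv k H (ω ⊗ₜ a) ⊗ₜ doubleEquiv k H (ω' ⊗ₜ a'))
      (Algebra.TensorProduct.map (codoubleEquiv k H).toAlgHom (codoubleEquiv k H).toAlgHom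
        ((inclOp k H c ⊗ₜ inclDual k H θ) * legJ (inclOp k H) (inclDual k H) z)) =
      ev k H ω c.unop * ev k H θ a' * ev k H ω' (toHom k H Hᵐᵒᵖ z a).unop := by
  induction z with
  | zero => simp
  | add p q hp hq =>
    refine (congrArg (fun t => ev₂ k (Codouble k H) (Codouble k H) _
      (Algebra.TensorProduct.map (codoubleEquiv k H).toAlgHom (codoubleEquiv k H).toAlgHom t))
      (mul_legJ_add _ p q)).trans ?_
    simp only [map_add, LinearMap.add_apply, MulOpposite.unop_add, mul_add, hp, hq]
  | tmul c' θ' =>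
    have e1 : inclOp k H c * inclDual k H θ' = c ⊗ₜ θ' := by simp [inclOp, inclDual]
    have e2 : inclDual k H θ * inclOp k H c' = c' ⊗ₜ θ := by simp [inclOp, inclDual]
    rw [legJ_tmul, Algebra.TensorProduct.tmul_mul_tmul, e1, e2, Algebra.TensorProduct.map_tmul,
      ev₂_tmul]
    refine (congrArg₂ (· * ·) (ev_doubleEquiv_codoubleEquiv ω a (c ⊗ₜ θ'))
      (ev_doubleEquiv_codoubleEquiv ω' a' (c' ⊗ₜ θ))).trans ?_
    simp
    ring

/-- The product of the double is dual to the twisted comultiplication of the codouble. The twist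
affects only the inner legs c₂ and θ₁, and these meet only a and ω'. -/
theorem ev_double_mul {ι κ : Type*} {c : H} {θ : HDual k H} (r : Repr k c ι) (s : Repr k θ κ)
    (ω ω' : HDual k H) (a a' : H) :
    ev k (Codouble k H) (doubleEquiv k H (ω ⊗ₜ a) * doubleEquiv k H (ω' ⊗ₜ a'))
      (codoubleEquiv k H (MulOpposite.op c ⊗ₜ θ)) = ∑ i ∈ r.index, ∑ j ∈ s.index,
        ev k H ω (r.left i) * ev k H (s.right j) a' * ev k H ω' (toHom k H Hᵐᵒᵖ
          (Ad k (opU k H) (MulOpposite.op (r.right i) ⊗ₜ s.left j)) a).unop := by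
  -- Passing to Hᵒᵖ does not change the comultiplication.
  let r' : Repr k (MulOpposite.op c) ι :=
    { index := r.index
      left := fun i => MulOpposite.op (r.left i)
      right := fun i => MulOpposite.op (r.right i)
      eq := by simp [MulOpposite.comul_def, ← r.eq] }
  have h : ∀ (d d' : DrinfeldDouble k H) (x : Codouble k H), ev k (Codouble k H) (d * d') x =
      ev₂ k (Codouble k H) (Codouble k H) (d ⊗ₜ d') (comul x) := by
    intro d d' x
    rw [ev_mul]
    induction (comul (R := k) x) with
    | zero => simp
    | add p q hp hq => simp only [map_add, hp, hq]
    | tmul p q => simp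
  rw [h, codouble_comul_tmul r' s]
  simp only [map_sum, ev₂_legJ_incl]
  rfl

/-- The twisted term is evaluated at 1, where conjugation is trivial. -/
theorem double_mul_of_left (ω ω' : HDual k H) (a : H) :
    doubleEquiv k H (ω ⊗ₜ 1) * doubleEquiv k H (ω' ⊗ₜ a) = doubleEquiv k H ((ω * ω') ⊗ₜ a) := by
  refine double_ext fun c θ => ?_
  -- Writing a as 1 · a produces θ₁(1) θ₂(a), the same splitting of θ as in the product formula.
  rw [ev_double_mul (ℛ k c) (ℛ k θ), ev_doubleEquiv, ev_mul_repr (ℛ k c), ← one_mul a,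
    ← dual_comul_repr (ℛ k θ), Finset.sum_mul_sum]
  refine Finset.sum_congr rfl fun i _ => Finset.sum_congr rfl fun j _ => ?_
  rw [toHom_Ad_opU_one]
  simp
  ring

/-- The twisted term is paired with 1 = ε, which does not see conjugation. -/
theorem double_mul_of_right (ω : HDual k H) (a a' : H) :
    doubleEquiv k H (ω ⊗ₜ a) * doubleEquiv k H (1 ⊗ₜ a') = doubleEquiv k H (ω ⊗ₜ (a * a')) := by
  refine double_ext fun c θ => ?_
  rw [ev_double_mul (ℛ k c) (ℛ k θ), ev_doubleEquiv, ← mul_one ω, ev_mul_repr (ℛ k c),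
    ← dual_comul_repr (ℛ k θ), Finset.sum_mul_sum]
  refine Finset.sum_congr rfl fun i _ => Finset.sum_congr rfl fun j _ => ?_
  rw [ev_one, counit_toHom_Ad_opU]
  simp
  ring

/-- In the remaining order of the factors, the outer legs meet ε and 1 and drop out, and the full
twist Ad(°U) is left. -/
theorem ev_double_mul_swap (ω : HDual k H) (a c : H) (θ : HDual k H) :
    ev k (Codouble k H) (doubleEquiv k H (1 ⊗ₜ a) * doubleEquiv k H (ω ⊗ₜ 1))
      (codoubleEquiv k H (MulOpposite.op c ⊗ₜ θ)) =
        ev k H ω (toHom k H Hᵐᵒᵖ (Ad k (opU k H) (MulOpposite.op c ⊗ₜ θ)) a).unop := by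
  -- Bilinearity in (c, θ) allows ε(c₁)c₂ = c and θ₁ε(θ₂) = θ to be used inside the twist.
  let e : H →ₗ[k] HDual k H →ₗ[k] k := LinearMap.mk₂ k (fun c θ => ev k H ω (toHom k H Hᵐᵒᵖ
      (Ad k (opU k H) (MulOpposite.op c ⊗ₜ θ)) a).unop)
    (by intros; simp only [MulOpposite.op_add, TensorProduct.add_tmul, map_add,
          LinearMap.add_apply, MulOpposite.unop_add])
    (by intros; simp only [MulOpposite.op_smul, ← TensorProduct.smul_tmul', map_smul,
          LinearMap.smul_apply, MulOpposite.unop_smul])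
    (by intros; simp only [TensorProduct.tmul_add, map_add, LinearMap.add_apply,
          MulOpposite.unop_add])
    (by intros; simp only [TensorProduct.tmul_smul, map_smul, LinearMap.smul_apply,
          MulOpposite.unop_smul])
  have hθ := congrArg (TensorProduct.rid k (HDual k H)) (sum_tmul_counit_eq (ℛ k θ))
  have h := congrArg₂ (fun c θ => e c θ) (sum_counit_smul (ℛ k c)) hθ
  simp only [map_sum, map_smul, LinearMap.sum_apply, LinearMap.smul_apply, TensorProduct.rid_tmul,
    smul_eq_mul, one_smul] at h
  rw [ev_double_mul (ℛ k c) (ℛ k θ)]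
  refine Eq.trans ?_ h
  rw [Finset.sum_comm]
  refine Finset.sum_congr rfl fun i _ => ?_
  simp only [Finset.mul_sum]
  exact Finset.sum_congr rfl fun j _ => by simp [e, mul_assoc, mul_left_comm]

variable (k H) in
/-- The action `(ω ◀ h)(x) = ω(h x)`. -/
noncomputable def coregAct : H →ₗ[k] HDual k H →ₗ[k] HDual k H :=
  LinearMap.mk₂ k (fun h ω => (ev k H).symm (ev k H ω ∘ₗ LinearMap.mulLeft k h))
    (by intros; exact dual_ext fun x => by simp [add_mul])
    (by intros; exact dual_ext fun x => by simp)
    (by intros; exact dual_ext fun x => by simp)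
    (by intros; exact dual_ext fun x => by simp)

omit [Module.Finite k H] in
@[simp] theorem ev_coregAct (h : H) (ω : HDual k H) (x : H) :
    ev k H (coregAct k H h ω) x = ev k H ω (h * x) := by simp [coregAct]

/-- The exchange relation of the Drinfeld double. -/
theorem double_exchange {ι : Type*} {a : H} (r : Repr k a ι) (ω : HDual k H) :
    ∑ i ∈ r.index, doubleEquiv k H (1 ⊗ₜ r.left i) *
        doubleEquiv k H (coregAct k H (r.right i) ω ⊗ₜ 1) =
      ∑ i ∈ r.index, doubleEquiv k H (regAct k H (r.left i) ω ⊗ₜ r.right i) := by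
  refine double_ext fun c θ => ?_
  simp only [map_sum, LinearMap.sum_apply, ev_double_mul_swap, ev_coregAct,
    ev_doubleEquiv_codoubleEquiv, ev_regAct]
  -- Paired with cᵒᵖ ⊗ θ, the two sides are ω applied to the two sides of `toHom_Ad_opU`.
  rw [← map_sum, toHom_Ad_opU r, map_sum]

theorem doubleEquiv_one : doubleEquiv k H (1 ⊗ₜ 1) = 1 := by
  refine double_ext fun c θ => ?_
  rw [ev_doubleEquiv]
  -- The unit of the double is the counit of the codouble, which the twist leaves unchanged.
  change _ = counit (R := k) (MulOpposite.op c ⊗ₜ[k] θ : Hᵐᵒᵖ ⊗[k] HDual k H)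
  simp [MulOpposite.counit_def, mul_comm]

/-- `Δ(h ▶ θ) = θ₁ ⊗ (h ▶ θ₂)` -/
noncomputable def reprRegAct {ι : Type*} {θ : HDual k H} (t : Repr k θ ι) (h : H) :
    Repr k (regAct k H h θ) ι where
  index := t.index
  left := t.left
  right i := regAct k H h (t.right i)
  eq := ev₂_ext fun x y => by
    simp [dual_comul_repr t, mul_assoc]

/-- Both sides are the functional x ⊗ y ↦ θ(x h y). -/
theorem sum_regAct_tmul {ι : Type*} {θ : HDual k H} (t : Repr k θ ι) (h : H) :
    ∑ i ∈ t.index, regAct k H h (t.left i) ⊗ₜ[k] t.right i =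
      ∑ i ∈ t.index, t.left i ⊗ₜ[k] coregAct k H h (t.right i) :=
  ev₂_ext fun x y => by simp [dual_comul_repr t, mul_assoc]

end DoubleMul

/-! ### Multiplicativity of Γ' and the slices of 𝕍₁₂𝕌₁₃. -/

section HeisenbergCoaction
variable {k : Type*} [Field k] {H : Type*} [Ring H] [HopfAlgebra k H]

theorem heisInl_apply (θ : HDual k H) : heisInl k H θ = heisEquiv k H (θ ⊗ₜ 1) := rfl

theorem heisInr_apply (h : H) : heisInr k H h = heisEquiv k H (1 ⊗ₜ h) := rfl

theorem heisInl_mul (θ θ' : HDual k H) (h : H) :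
    heisInl k H θ * heisEquiv k H (θ' ⊗ₜ h) = heisEquiv k H ((θ * θ') ⊗ₜ h) := by
  rw [heisInl_apply, heis_mul (reprOne k H)]
  simp [reprOne]

theorem heisInl_mul_heisInr (θ : HDual k H) (h : H) :
    heisInl k H θ * heisInr k H h = heisEquiv k H (θ ⊗ₜ h) := by
  rw [heisInr_apply, heisInl_mul, mul_one]

theorem mul_heisInr (θ : HDual k H) (h h' : H) :
    heisEquiv k H (θ ⊗ₜ h) * heisInr k H h' = heisEquiv k H (θ ⊗ₜ (h * h')) := by
  rw [← heisInl_mul_heisInr, mul_assoc, ← map_mul, heisInl_mul_heisInr]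

/-- The Heisenberg counterpart of `double_exchange`; here only the left regular action enters. -/
theorem heisInr_mul_heisInl {ι : Type*} {h : H} (r : Repr k h ι) (θ : HDual k H) :
    heisInr k H h * heisInl k H θ =
      ∑ i ∈ r.index, heisEquiv k H (regAct k H (r.left i) θ ⊗ₜ r.right i) := by
  rw [heisInl_apply, heisInr_apply, heis_mul r]
  simp

theorem heis_induction {p : Heisenberg k H → Prop} (hadd : ∀ x y, p x → p y → p (x + y))
    (htmul : ∀ θ h, p (heisEquiv k H (θ ⊗ₜ h))) (x : Heisenberg k H) : p x := by
  obtain ⟨x, rfl⟩ := (heisEquiv k H).surjective x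
  induction x with
  | zero => simpa using htmul 0 0
  | add p q hp hq => rw [map_add]; exact hadd _ _ hp hq
  | tmul θ h => exact htmul θ h

variable [Module.Finite k H]

theorem leftCoaction_heisInl {ι : Type*} {θ : HDual k H} (r : Repr k θ ι) :
    leftCoaction k H (heisInl k H θ) = ∑ i ∈ r.index,
      doubleEquiv k H (r.right i ⊗ₜ 1) ⊗ₜ heisInl k H (r.left i) := by
  rw [heisInl_apply, leftCoaction_heisEquiv r (reprOne k H)]
  simp [reprOne, heisInl_apply]

theorem leftCoaction_heisInr {ι : Type*} {h : H} (r : Repr k h ι) :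
    leftCoaction k H (heisInr k H h) = ∑ i ∈ r.index,
      doubleEquiv k H (1 ⊗ₜ r.left i) ⊗ₜ heisInr k H (r.right i) := by
  rw [heisInr_apply, leftCoaction_heisEquiv (reprOne k (HDual k H)) r]
  simp [reprOne, heisInr_apply]

/-- Left multiplication by θ # 1 in 𝓗(Ĥ) and by ω ⋈ 1 in 𝓓(H) involves only the Ĥ-leg, so
multiplicativity of Δ on Ĥ suffices. -/
theorem leftCoaction_heisInl_mul (θ : HDual k H) (y : Heisenberg k H) :
    leftCoaction k H (heisInl k H θ * y) =
      leftCoaction k H (heisInl k H θ) * leftCoaction k H y := by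
  induction y using heis_induction with
  | hadd x y hx hy => simp only [mul_add, map_add, hx, hy]
  | htmul θ' h =>
    rw [heisInl_mul, leftCoaction_heisEquiv (reprMul (ℛ k θ) (ℛ k θ')) (ℛ k h),
      leftCoaction_heisInl (ℛ k θ), leftCoaction_heisEquiv (ℛ k θ') (ℛ k h)]
    simp only [reprMul, Finset.sum_product, Finset.sum_mul, Finset.mul_sum,
      Algebra.TensorProduct.tmul_mul_tmul, double_mul_of_left, heisInl_mul]
    rw [Finset.sum_comm]
    exact Finset.sum_congr rfl fun _ _ => Finset.sum_comm

/-- The mirror case: right multiplication by 1 # h and by 1 ⋈ a involves only the H-leg. -/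
theorem leftCoaction_mul_heisInr (x : Heisenberg k H) (h : H) :
    leftCoaction k H (x * heisInr k H h) =
      leftCoaction k H x * leftCoaction k H (heisInr k H h) := by
  induction x using heis_induction with
  | hadd x y hx hy => simp only [add_mul, map_add, hx, hy]
  | htmul θ g =>
    rw [mul_heisInr, leftCoaction_heisEquiv (ℛ k θ) (reprMul (ℛ k g) (ℛ k h)),
      leftCoaction_heisInr (ℛ k h), leftCoaction_heisEquiv (ℛ k θ) (ℛ k g)]
    simp only [reprMul, Finset.sum_product, Finset.sum_mul, Finset.mul_sum,
      Algebra.TensorProduct.tmul_mul_tmul, double_mul_of_right, mul_heisInr]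
    exact (Finset.sum_congr rfl fun _ _ => Finset.sum_comm).trans Finset.sum_comm

/-- The decisive case. With (ω ◀ a)(x) = ω(ax), the right side is (1 ⋈ h₁)(θ₂ ⋈ 1) ⊗ ((h₂ ▶ θ₁) #
h₃), which equals (1 ⋈ h₁)((θ₂ ◀ h₂) ⋈ 1) ⊗ (θ₁ # h₃) by `sum_regAct_tmul`. The exchange relation
turns this into ((h₁ ▶ θ₂) ⋈ h₂) ⊗ (θ₁ # h₃), and this is Γ'((h₁ ▶ θ) # h₂). -/
theorem leftCoaction_heisInr_mul_heisInl (h : H) (θ : HDual k H) :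
    leftCoaction k H (heisInr k H h * heisInl k H θ) =
      leftCoaction k H (heisInr k H h) * leftCoaction k H (heisInl k H θ) := by
  let D := DrinfeldDouble k H
  let r := ℛ k h
  let t := ℛ k θ
  -- Both sides are packaged as trilinear maps of (h₁, h₂, h₃) so that `sweedler_assoc` applies.
  -- They differ only in the D-valued part: `G₁` and `G₂` are the two sides of the exchange
  -- relation.
  let F : HDual k H → (H →ₗ[k] H →ₗ[k] D) → H →ₗ[k] H →ₗ[k] H →ₗ[k] D ⊗[k] Heisenberg k H :=
    fun ω G => G.compr₂ ((LinearMap.lcomp k _ ((heisEquiv k H).toLinearMap ∘ₗ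
      TensorProduct.mk k (HDual k H) H ω)) ∘ₗ TensorProduct.mk k D (Heisenberg k H))
  have hF : ∀ ω G a b c, F ω G a b c = G a b ⊗ₜ heisEquiv k H (ω ⊗ₜ c) := fun _ _ _ _ _ => rfl
  let G₁ : HDual k H → H →ₗ[k] H →ₗ[k] D := fun ω => (LinearMap.mul k D).compl₁₂
    ((doubleEquiv k H).toLinearMap ∘ₗ TensorProduct.mk k (HDual k H) H 1)
    ((doubleEquiv k H).toLinearMap ∘ₗ (TensorProduct.mk k (HDual k H) H).flip 1 ∘ₗ
      (coregAct k H).flip ω)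
  have hG₁ : ∀ ω a b, G₁ ω a b = doubleEquiv k H (1 ⊗ₜ a) *
    doubleEquiv k H (coregAct k H b ω ⊗ₜ 1) := fun _ _ _ => rfl
  let G₂ : HDual k H → H →ₗ[k] H →ₗ[k] D := fun ω => ((TensorProduct.mk k (HDual k H) H) ∘ₗ
    (regAct k H).toLinearMap.flip ω).compr₂ (doubleEquiv k H).toLinearMap
  have hG₂ : ∀ ω a b, G₂ ω a b = doubleEquiv k H (regAct k H a ω ⊗ₜ b) := fun _ _ _ => rfl
  -- The action of a is moved from the Heisenberg leg θ₁ to the double leg θ₂.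
  have hswap : ∀ (d : D) (a b : H), ∑ j ∈ t.index, (d * doubleEquiv k H (t.right j ⊗ₜ 1)) ⊗ₜ[k]
      heisEquiv k H (regAct k H a (t.left j) ⊗ₜ b) =
      ∑ j ∈ t.index, (d * doubleEquiv k H (coregAct k H a (t.right j) ⊗ₜ 1)) ⊗ₜ[k]
        heisEquiv k H (t.left j ⊗ₜ b) := by
    intro d a b
    have := congrArg (TensorProduct.map
      (LinearMap.mulLeft k d ∘ₗ (doubleEquiv k H).toLinearMap ∘ₗ
        (TensorProduct.mk k (HDual k H) H).flip 1)
      ((heisEquiv k H).toLinearMap ∘ₗ (TensorProduct.mk k (HDual k H) H).flip b) ∘ₗ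
        (TensorProduct.comm k (HDual k H) (HDual k H)).toLinearMap) (sum_regAct_tmul t a)
    simpa using this
  have hl : leftCoaction k H (heisInr k H h * heisInl k H θ) = ∑ j ∈ t.index, ∑ i ∈ r.index,
      ∑ l ∈ (ℛ k (r.right i)).index, F (t.left j) (G₂ (t.right j)) (r.left i)
        ((ℛ k (r.right i)).left l) ((ℛ k (r.right i)).right l) := by
    rw [heisInr_mul_heisInl r, map_sum, Finset.sum_comm]
    refine Finset.sum_congr rfl fun i _ => ?_
    rw [leftCoaction_heisEquiv (reprRegAct t (r.left i)) (ℛ k (r.right i))]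
    rfl
  have hr : leftCoaction k H (heisInr k H h) * leftCoaction k H (heisInl k H θ) =
      ∑ j ∈ t.index, ∑ i ∈ r.index,
        ∑ l ∈ (ℛ k (r.right i)).index, F (t.left j) (G₁ (t.right j)) (r.left i)
          ((ℛ k (r.right i)).left l) ((ℛ k (r.right i)).right l) := by
    rw [leftCoaction_heisInr r, leftCoaction_heisInl t, Finset.sum_mul_sum]
    conv_rhs => rw [Finset.sum_comm]
    refine Finset.sum_congr rfl fun i _ => ?_
    simp only [Algebra.TensorProduct.tmul_mul_tmul, heisInr_mul_heisInl (ℛ k (r.right i)),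
      TensorProduct.tmul_sum]
    rw [Finset.sum_comm]
    conv_rhs => rw [Finset.sum_comm]
    exact Finset.sum_congr rfl fun l _ => hswap _ _ _
  rw [hl, hr]
  refine Finset.sum_congr rfl fun j _ => ?_
  -- Regroup so that h₁ and h₂ come from one comultiplication, as the exchange relation requires.
  rw [← sweedler_assoc _ r (fun i => ℛ k (r.left i)), ← sweedler_assoc _ r (fun i => ℛ k (r.left i))]
  refine Finset.sum_congr rfl fun i _ => ?_
  simp only [hF, hG₁, hG₂, ← TensorProduct.sum_tmul]
  rw [double_exchange]

/-- Factor (θ # h)(θ' # h') as (θ # 1) · ((1 # h)(θ' # 1)) · (1 # h'): the outer factors split off,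
and the middle one is the decisive case. -/
theorem leftCoaction_mul (x y : Heisenberg k H) :
    leftCoaction k H (x * y) = leftCoaction k H x * leftCoaction k H y := by
  induction x using heis_induction with
  | hadd x x' hx hx' => simp only [add_mul, map_add, hx, hx']
  | htmul θ h =>
    induction y using heis_induction with
    | hadd y y' hy hy' => simp only [mul_add, map_add, hy, hy']
    | htmul θ' h' =>
      rw [← heisInl_mul_heisInr, ← heisInl_mul_heisInr, mul_assoc, ← mul_assoc (heisInr k H h),
        leftCoaction_heisInl_mul, leftCoaction_mul_heisInr, leftCoaction_heisInr_mul_heisInl,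
        leftCoaction_heisInl_mul, leftCoaction_heisInl_mul]
      simp only [mul_assoc]

theorem doubleToHeis_tmul (ω : HDual k H) (a : H) :
    doubleToHeis k H (doubleEquiv k H (ω ⊗ₜ a)) = heisEquiv k H (ω ⊗ₜ a) := by
  simp [doubleToHeis]

theorem doubleToHeis_one : doubleToHeis k H 1 = 1 := by
  rw [← doubleEquiv_one, doubleToHeis_tmul, heis_one]

theorem dslice_canW (d : DrinfeldDouble k H) :
    dslice d (canW k H : DrinfeldDouble k H ⊗[k] Codouble k H) = d := by
  refine dual_ext fun x => ?_
  have key : ∀ t : Codouble k H ⊗[k] DrinfeldDouble k H,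
      ev k (Codouble k H) (dslice d (TensorProduct.comm k _ _ t)) x =
        ev k (Codouble k H) d (toHom k (Codouble k H) (Codouble k H) t x) := by
    intro t
    induction t with
    | zero => simp
    | add p q hp hq => simp only [map_add, LinearMap.add_apply, hp, hq]
    | tmul p q => simp [mul_comm]
  refine (key _).trans ?_
  simp [canU, canonicalUnit]

/-- The pairing of ω ⋈ a with cᵒᵖ ⊗ θ is the product ω(c) θ(a), so the slice of s₁₂t₁₃ factors. -/
theorem dslice_opIncl_mul_dualIncl (ω : HDual k H) (a : H) (s : Heisenberg k H ⊗[k] Hᵐᵒᵖ)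
    (t : Heisenberg k H ⊗[k] HDual k H) :
    dslice (doubleEquiv k H (ω ⊗ₜ a))
      (Algebra.TensorProduct.map (AlgHom.id k (Heisenberg k H))
        ((codoubleEquiv k H).toAlgHom.comp Algebra.TensorProduct.includeLeft) s *
      Algebra.TensorProduct.map (AlgHom.id k (Heisenberg k H))
        ((codoubleEquiv k H).toAlgHom.comp Algebra.TensorProduct.includeRight) t) =
      TensorProduct.rid k _ ((ev k H ω ∘ₗ
        (MulOpposite.opLinearEquiv k).symm.toLinearMap).lTensor _ s) *
          toHom k H (Heisenberg k H) t a := by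
  induction s with
  | zero => simp
  | add p q hp hq => simp only [map_add, add_mul, hp, hq]
  | tmul x c =>
    induction t with
    | zero => simp
    | add p q hp hq => simp only [map_add, mul_add, LinearMap.add_apply, hp, hq]
    | tmul y θ =>
      induction c using MulOpposite.rec' with | _ c => ?_
      have := ev_doubleEquiv k H ω a c θ
      simp only [Algebra.TensorProduct.map_tmul, Algebra.TensorProduct.tmul_mul_tmul, dslice_tmul,
        AlgHom.comp_apply, ← map_mul, Algebra.TensorProduct.includeLeft_apply,
        Algebra.TensorProduct.includeRight_apply, one_mul, mul_one]
      refine (congrArg (· • (x * y)) this).trans ?_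
      simp [mul_smul, smul_comm (ev k H ω c)]

/-- Thus 𝕍₁₂𝕌₁₃ is the image of 𝕎 under ω ⋈ a ↦ ω # a, the form of u required by the general
construction. -/
theorem dslice_heisUnit (d : DrinfeldDouble k H) :
    dslice d (heisUnit k H : Heisenberg k H ⊗[k] Codouble k H) = doubleToHeis k H d := by
  obtain ⟨z, rfl⟩ := (doubleEquiv k H).surjective d
  induction z with
  | zero => simp [dslice]
  | add p q hp hq =>
    have hadd : ∀ (d d' : DrinfeldDouble k H) (s : Heisenberg k H ⊗[k] Codouble k H),
        dslice (d + d') s = dslice d s + dslice d' s := by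
      intro d d' s
      simp [dslice, LinearMap.lTensor_add]
    simp only [map_add, hadd, hp, hq]
  | tmul ω a =>
    refine (dslice_opIncl_mul_dualIncl ω a _ _).trans ?_
    rw [doubleToHeis_tmul, ← heisInl_mul_heisInr]
    congr 1
    -- Slicing the op leg of a flipped tensor s by ω leaves the functional x ↦ ω(s(x)). For s = °U,
    -- where s(x) = op x, this is ω itself.
    · have key : ∀ s : Hᵐᵒᵖ ⊗[k] HDual k H, TensorProduct.rid k _ ((ev k H ω ∘ₗ
          (MulOpposite.opLinearEquiv k).symm.toLinearMap).lTensor _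
            ((Algebra.TensorProduct.map (heisInl k H) (AlgHom.id k Hᵐᵒᵖ))
              (TensorProduct.comm k _ _ s))) = heisInl k H ((ev k H).symm (ev k H ω ∘ₗ
                (MulOpposite.opLinearEquiv k).symm.toLinearMap ∘ₗ toHom k H Hᵐᵒᵖ s)) := by
        intro s
        induction s with
        | zero => simp
        | add p q hp hq => simp only [map_add, LinearMap.comp_add, hp, hq]
        | tmul c θ =>
          have : (ev k H).symm (ev k H ω ∘ₗ (MulOpposite.opLinearEquiv k).symm.toLinearMap ∘ₗ
              toHom k H Hᵐᵒᵖ (c ⊗ₜ θ)) = ev k H ω c.unop • θ :=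
            dual_ext fun x => by simp [mul_comm]
          rw [this]
          simp
      refine (key _).trans (congrArg _ (dual_ext fun x => ?_))
      simp
    -- Evaluating the canonical element U at a gives a, hence 𝕌 gives 1 # a.
    · refine (toHom_rTensor (heisInr k H).toLinearMap _ a).trans ?_
      simp [canU, canonicalUnit]

end HeisenbergCoaction

end HopfYD

theorem mainTheorem12 {k : Type*} [Field k] {H : Type*} [Ring H] [HopfAlgebra k H]
    [Module.Finite k H] :
    HopfYD.IsLeftRightYD (HopfYD.canW k H) (HopfYD.leftCoaction k H) (HopfYD.rightCoaction k H) ∧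
      HopfYD.IsLeftLeftYD (HopfYD.leftAction k H) (HopfYD.leftCoaction k H) := by
  have h : HopfYD.IsLeftRightYD (HopfYD.canW k H) (HopfYD.leftCoaction k H)
      (HopfYD.rightCoaction k H) :=
    -- By definition, Γ' is the coaction transported along `doubleToHeis` and Γ is `adCoaction` of
    -- `heisUnit`. In the same way ▷ is `actOfCoaction` of Γ, so the second claim follows from the
    -- first.
    HopfYD.isLeftRightYD_transport HopfYD.dslice_canW HopfYD.dslice_heisUnit
      HopfYD.doubleToHeis_one HopfYD.leftCoaction_mul
  exact ⟨h, h.isLeftLeftYD HopfYD.dslice_canW⟩
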